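/- All graphs are finite and simple, and a planar graph is one that can be drawn in the plane without crossings. A straight-line embedding of a graph $G$ is an injective map $\pi:V(G)\to\mathbb{R}^2$ such that drawing every edge $uv$ as the segment from $\pi(u)$ to $\pi(v)$ gives a crossing-free drawing of $G$ (no vertex lies on an edge that it is not an end of, and two distinct edges meet at most in a common end). A set $\mathcal{G}$ of planar graphs on $n$ vertices is simultaneously embeddable if there is a set $P\subseteq\mathbb{R}^2$ of $n$ points such that every $G\in\mathcal{G}$ has a straight-line embedding with all vertices mapped into $P$; otherwise $\mathcal{G}$ is called a conflict collection. Let $\sigma(n)$ denote the smallest size of a conflict collection of $n$-vertex planar graphs (with $\sigma(n)=\infty$ if there is none). The orientation of a triple $(a,b,c)$ of points $a=(a_1,a_2)$, $b=(b_1,b_2)$, $c=(c_1,c_2)$ of $\mathbb{R}^2$ is the sign, in $\{-1,0,1\}$, of $\det\begin{pmatrix}1&1&1\\a_1&b_1&c_1\\a_2&b_2&c_2\end{pmatrix}$. Two labelled sets $\{p_1,\dots,p_n\}$ and $\{q_1,\dots,q_n\}$ of $n$ distinct points in the plane are isomorphic if for all $1\le i,j,k\le n$ the triples $p_ip_jp_k$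 and $q_iq_jq_k$ have the same orientation. Let $t_s(n,2)$ be the number of simple labelled order types of $n$ points, that is, the number of isomorphism classes of labelled sets of $n$ distinct points in $\mathbb{R}^2$ of which no three lie on a common line. **Theorem.** For every integer $n\ge 16$, there exists a conflict collection of $n$-vertex planar graphs, and $$\sigma(n)\le\left\lfloor\frac{\log_2(t_s(n,2))-(n-4)-\log_2((n-3)!)}{n-\log_2(16n(n-1)(n-2))}\right\rfloor+2.$$ -/

import Mathlib

namespace PlanarConflict

/-- The Euclidean plane, as an affine and topological space. -/
abbrev Plane : Type := ℝ × ℝ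

/-! ### Drawings, planar graphs and straight-line embeddings -/

/-- `A` is a simple arc with end points `x` and `y`. -/
def IsSimpleArc (A : Set Plane) (x y : Plane) : Prop :=
  ∃ γ : Path x y, Function.Injective γ ∧ Set.range γ = A

/-- Placing every vertex `v` of `G` at `p v` and drawing every edge `e` as the set `arc e` is a
crossing-free drawing: distinct vertices are placed at distinct points, an edge contains no vertex
other than its two ends, and two distinct edges meet at most in a common end. -/
structure IsCrossingFree {V : Type*} (G : SimpleGraph V) (p : V → Plane)
    (arc : Sym2 V → Set Plane) : Prop where
  injective : Function.Injective p
  vertex_mem : ∀ e ∈ G.edgeSet, ∀ w : V, p w ∈ arc e → w ∈ e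
  edge_inter : ∀ e ∈ G.edgeSet, ∀ f ∈ G.edgeSet, e ≠ f →
    arc e ∩ arc f ⊆ p '' {w | w ∈ e ∧ w ∈ f}

/-- A graph is planar if it has a crossing-free drawing in the plane in which every edge is a
simple arc between the positions of its two ends. -/
def IsPlanar {V : Type*} (G : SimpleGraph V) : Prop :=
  ∃ (p : V → Plane) (arc : Sym2 V → Set Plane),
    (∀ u v : V, G.Adj u v → IsSimpleArc (arc s(u, v)) (p u) (p v)) ∧ IsCrossingFree G p arc

/-- The straight-line segment between the positions of the two ends of a pair of vertices. -/
def straightArc {V : Type*} (p : V → Plane) : Sym2 V → Set Plane :=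
  Sym2.lift ⟨fun u v => segment ℝ (p u) (p v), fun u v => segment_symm ℝ (p u) (p v)⟩

/-- `p` is a straight-line embedding of `G` in the plane. -/
def IsStraightLineEmbedding {V : Type*} (G : SimpleGraph V) (p : V → Plane) : Prop :=
  IsCrossingFree G p (straightArc p)

/-- `G` has a straight-line embedding on the point set `P`. -/
def EmbedsOn {V : Type*} (G : SimpleGraph V) (P : Set Plane) : Prop :=
  ∃ p : V → Plane, (∀ v, p v ∈ P) ∧ IsStraightLineEmbedding G p

/-! ### Conflict collections -/

/-- A collection of `n`-vertex graphs is simultaneously embeddable (without mapping) if all its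
members have straight-line embeddings on one common set of `n` points. -/
def SimultaneouslyEmbeddable {n : ℕ} (𝒢 : Finset (SimpleGraph (Fin n))) : Prop :=
  ∃ P : Finset Plane, P.card = n ∧ ∀ G ∈ 𝒢, EmbedsOn G (P : Set Plane)

/-- A conflict collection: a set of planar `n`-vertex graphs that is not simultaneously
embeddable. -/
def IsConflictCollection {n : ℕ} (𝒢 : Finset (SimpleGraph (Fin n))) : Prop :=
  (∀ G ∈ 𝒢, IsPlanar G) ∧ ¬ SimultaneouslyEmbeddable 𝒢

/-- `σ(n)`, the smallest size of a conflict collection of `n`-vertex planar graphs; it is `⊤` if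
there is no such collection. -/
noncomputable def sigma (n : ℕ) : ℕ∞ :=
  ⨅ (𝒢 : Finset (SimpleGraph (Fin n))) (_ : IsConflictCollection 𝒢), (𝒢.card : ℕ∞)

/-! ### Labelled order types -/

/-- The orientation of a triple of points in the plane. -/
noncomputable def orient (a b c : Plane) : SignType :=
  SignType.sign (Matrix.det !![1, 1, 1; a.1, b.1, c.1; a.2, b.2, c.2])

/-- A labelled set of `n` distinct points `p 0, …, p (n - 1)` in the plane, no three of which lie
on a common line. -/
structure SimpleLabelledPointSet (n : ℕ) where
  point : Fin n → Plane
  injective : Function.Injective point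
  general : ∀ i j k : Fin n, i ≠ j → i ≠ k → j ≠ k →
    ¬ Collinear ℝ {point i, point j, point k}

/-- Isomorphism of labelled point sets: all triples of labels have the same orientation. -/
def isomorphySetoid (n : ℕ) : Setoid (SimpleLabelledPointSet n) where
  r P Q := ∀ i j k : Fin n,
    orient (P.point i) (P.point j) (P.point k) = orient (Q.point i) (Q.point j) (Q.point k)
  iseqv := ⟨fun _ _ _ _ => rfl, fun h i j k => (h i j k).symm,
    fun h h' i j k => (h i j k).trans (h' i j k)⟩

/-- A simple labelled order type of `n` points: an isomorphism class. -/
abbrev SimpleLabelledOrderType (n : ℕ) : Type := Quotient (isomorphySetoid n)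

/-- There are only finitely many simple labelled order types of `n` points. -/
instance finite_simpleLabelledOrderType (n : ℕ) : Finite (SimpleLabelledOrderType n) := by
  refine Finite.of_injective (β := Fin n → Fin n → Fin n → SignType)
    (Quotient.lift (fun P i j k => orient (P.point i) (P.point j) (P.point k))
      fun P Q h => by funext i j k; exact h i j k) ?_
  rintro ⟨P⟩ ⟨Q⟩ h
  exact Quotient.sound fun i j k => congrFun (congrFun (congrFun h i) j) k

/-- `t_s(n, 2)`, the number of simple labelled order types of `n` points in the plane. -/
noncomputable def numSimpleOrderTypes (n : ℕ) : ℕ :=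
  Nat.card (SimpleLabelledOrderType n)

end PlanarConflict

/-! The witnesses are stacked triangulations labelled in stacking order: start with a complete graph
on four vertices and repeatedly join a new vertex to the three corners of a face. A stage with m
vertices offers 2(m - 2) faces, so there are T = 2^(n-4) (n-3)! of them (`exists_stacked_finset`).
Each has a straight-line drawing (`Stacked.exists_isDrawing`), hence is planar.

The central fact is that labelled points in general position carry at most one of these labelled
graphs (`IsAttachment.eq_of_nonCrossing`). In a drawing, some triangle on the vertices below i
separates point i from all other points below i (`exists_separating`). An edge from i to an earlier
vertex that is not a corner would cross that triangle, so the three lower neighbours of i are its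
corners. By induction the points determine the graph. Hence an order type realises at most one of
the T graphs with its own labels, and at most n! of them when relabelling is allowed.

Averaging yields a graph f₁ realised with its own labels by only M order types, where M T ≤
t_s(n,2). If a collection containing f₁ is simultaneously embeddable, the common points can be
perturbed into general position and labelled by the embedding of f₁, which gives one of these M
order types (`SimultaneouslyEmbeddable.exists_rep`). Averaging again, each further graph can be
chosen to be realisable on at most the fraction n!/T of the surviving order types
(`exists_small_unrelated`). None survives k rounds if M (n!)^k < T^k, so k + 1 graphs suffice. As
T/n! = 2^n / (16 n(n-1)(n-2)), taking logarithms gives the bound.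

The planar geometry behind the central fact involves at most five points at a time and is settled by
a finite check over their orientation signs. -/

namespace PlanarConflict

open Set Filter Topology

set_option linter.unusedSimpArgs false

/-! ### Orientations, triangles and crossings as Boolean data. -/

/-- Twice the signed area of a triangle. -/
noncomputable def area (a b c : Plane) : ℝ :=
  (b.1 - a.1) * (c.2 - a.2) - (b.2 - a.2) * (c.1 - a.1)

/-- Whether a triple of points is positively oriented. -/
noncomputable def pos (a b c : Plane) : Bool := decide (0 < area a b c)

/-- Whether `x` lies inside the triangle `a b c` (for points in general position). -/
noncomputable def ins (a b c x : Plane) : Bool :=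
  (pos a b x == pos b c x) && (pos b c x == pos c a x)

/-- Whether the segments `a b` and `c d` cross (for points in general position). -/
noncomputable def cross (a b c d : Plane) : Bool :=
  (pos a b c != pos a b d) && (pos c d a != pos c d b)

theorem pos_rotate (a b c : Plane) : pos b c a = pos a b c := by
  simp only [pos, area]; congr 2; ring

theorem pos_swap {a b c : Plane} (h : area a b c ≠ 0) : pos b a c = !pos a b c := by
  have : area b a c = -area a b c := by simp only [area]; ring
  simp only [pos, this]
  rcases h.lt_or_gt with h | h
  · simp [h, h.le]
  · simp [h, h.le]

/-- The orientations of all reorderings of a triple. -/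
theorem pos_perm {a b c : Plane} (h : area a b c ≠ 0) :
    pos b c a = pos a b c ∧ pos c a b = pos a b c ∧ pos b a c = (!pos a b c) ∧
      pos a c b = (!pos a b c) ∧ pos c b a = (!pos a b c) := by
  have h1 := pos_swap h
  refine ⟨pos_rotate a b c, (pos_rotate c a b).symm, h1, ?_, ?_⟩
  · rw [← h1]; exact pos_rotate b a c
  · rw [← h1, pos_rotate, pos_rotate]

theorem area_ne_swap {a b c : Plane} (h : area a b c ≠ 0) : area b a c ≠ 0 := by
  intro h'; apply h; simp only [area] at *; linarith

theorem area_ne_rotate {a b c : Plane} (h : area a b c ≠ 0) : area b c a ≠ 0 := by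
  intro h'; apply h; simp only [area] at *; linarith

/-! ### Five-point configurations via orientation signs. -/

/-- The sign condition for a vanishing alternating sum of four numbers. -/
def signs₄ (x y z w : Bool) : Bool := !(w && !z && y && !x) && !(!w && z && !y && x)

/-- The sign condition for a three-term Grassmann–Plücker relation. -/
def signs₃ (x x' y y' z z' : Bool) : Bool :=
  !((x == x') && !(y == y') && (z == z')) && !(!(x == x') && (y == y') && !(z == z'))

/-- The relations between the orientations of the triples of five points. -/
def chirotope₅ (abc abd abe acd ace ade bcd bce bde cde : Bool) : Bool :=
  signs₄ abc abd acd bcd && signs₄ abc abe ace bce && signs₄ abd abe ade bde &&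
  signs₄ acd ace ade cde && signs₄ bcd bce bde cde &&
  signs₃ abc ade abd ace abe acd && signs₃ abc bde abd bce abe bcd &&
  signs₃ abc cde acd bce ace bcd && signs₃ abd cde acd bde ade bcd &&
  signs₃ abe cde ace bde ade bce

/-- Five points in general position. -/
structure Generic₅ (a b c d e : Plane) : Prop where
  abc : area a b c ≠ 0
  abd : area a b d ≠ 0
  abe : area a b e ≠ 0
  acd : area a c d ≠ 0
  ace : area a c e ≠ 0
  ade : area a d e ≠ 0
  bcd : area b c d ≠ 0
  bce : area b c e ≠ 0
  bde : area b d e ≠ 0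
  cde : area c d e ≠ 0

theorem signs₄_pos {a b c d : Plane} (h1 : area a b c ≠ 0) (h2 : area a b d ≠ 0)
    (h3 : area a c d ≠ 0) (h4 : area b c d ≠ 0) :
    signs₄ (pos a b c) (pos a b d) (pos a c d) (pos b c d) = true := by
  have key : area b c d - area a c d + area a b d - area a b c = 0 := by
    simp only [area]; ring
  simp only [signs₄, pos]
  rcases h1.lt_or_gt with h1 | h1 <;> rcases h2.lt_or_gt with h2 | h2 <;>
  rcases h3.lt_or_gt with h3 | h3 <;> rcases h4.lt_or_gt with h4 | h4 <;>
  simp [h1, h2, h3, h4, h1.le, h2.le, h3.le, h4.le] <;> linarith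

theorem decide_mul_pos {x y : ℝ} (hx : x ≠ 0) (hy : y ≠ 0) :
    (decide (0 < x) == decide (0 < y)) = decide (0 < x * y) := by
  rcases hx.lt_or_gt with hx | hx <;> rcases hy.lt_or_gt with hy | hy
  · simp [hx.not_gt, hy.not_gt, mul_pos_of_neg_of_neg hx hy]
  · simp [hx.not_gt, hy, (mul_neg_of_neg_of_pos hx hy).not_gt]
  · simp [hx, hy.not_gt, (mul_neg_of_pos_of_neg hx hy).not_gt]
  · simp [hx, hy]

theorem signs₃_decide {x x' y y' z z' : ℝ} (hx : x ≠ 0) (hx' : x' ≠ 0) (hy : y ≠ 0)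
    (hy' : y' ≠ 0) (hz : z ≠ 0) (hz' : z' ≠ 0) (h : x * x' - y * y' + z * z' = 0) :
    signs₃ (decide (0 < x)) (decide (0 < x')) (decide (0 < y)) (decide (0 < y'))
      (decide (0 < z)) (decide (0 < z')) = true := by
  simp only [signs₃, decide_mul_pos hx hx', decide_mul_pos hy hy', decide_mul_pos hz hz']
  have h1 := mul_ne_zero hx hx'
  have h2 := mul_ne_zero hy hy'
  have h3 := mul_ne_zero hz hz'
  generalize x * x' = X at *
  generalize y * y' = Y at *
  generalize z * z' = Z at *
  rcases h1.lt_or_gt with h1 | h1 <;> rcases h2.lt_or_gt with h2 | h2 <;>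
  rcases h3.lt_or_gt with h3 | h3 <;>
  simp [h1, h2, h3, h1.le, h2.le, h3.le] <;> linarith

/-- The areas are the 3 × 3 minors of five homogeneous vectors with first coordinate 1. The first
five conditions come from the affine relation among four points, the last five from the three-term
Grassmann–Plücker relations. These necessary conditions exclude enough of the 2^10 sign patterns for
the lemmas below to follow by `decide`. -/
theorem Generic₅.chirotope {a b c d e : Plane} (h : Generic₅ a b c d e) :
    chirotope₅ (pos a b c) (pos a b d) (pos a b e) (pos a c d) (pos a c e) (pos a d e)
      (pos b c d) (pos b c e) (pos b d e) (pos c d e) = true := by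
  obtain ⟨h1, h2, h3, h4, h5, h6, h7, h8, h9, h10⟩ := h
  simp only [chirotope₅, Bool.and_eq_true]
  refine ⟨⟨⟨⟨⟨⟨⟨⟨⟨?_, ?_⟩, ?_⟩, ?_⟩, ?_⟩, ?_⟩, ?_⟩, ?_⟩, ?_⟩, ?_⟩
  iterate 5 (first | apply signs₄_pos <;> assumption)
  all_goals
    apply signs₃_decide <;> first | assumption | (simp only [area]; ring)

/-- A segment joining two points on different sides of a triangle crosses the triangle. -/
theorem Generic₅.cross_of_ins_ne {a b c x w : Plane} (h : Generic₅ a b c x w)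
    (hne : ins a b c w ≠ ins a b c x) :
    cross w x a b = true ∨ cross w x b c = true ∨ cross w x c a = true := by
  have H := h.chirotope
  revert hne H
  simp only [ins, cross, pos_perm h.abc, pos_perm h.abd, pos_perm h.abe, pos_perm h.acd,
    pos_perm h.ace, pos_perm h.ade, pos_perm h.bcd, pos_perm h.bce, pos_perm h.bde,
    pos_perm h.cde]
  generalize pos a b c = abc, pos a b x = abd, pos a b w = abe, pos a c x = acd,
    pos a c w = ace, pos a x w = ade, pos b c x = bcd, pos b c w = bce, pos b x w = bde,
    pos c x w = cde
  revert abc abd abe acd ace ade bcd bce bde cde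
  decide

set_option synthInstance.maxHeartbeats 200000 in
set_option synthInstance.maxSize 1000 in
/-- When `v` is joined to the corners of a triangle without crossing it, the points on the other
side of the triangle are on the same side of each new triangle as its missing corner. -/
theorem Generic₅.ins_new_eq {a b c v w : Plane} (h : Generic₅ a b c v w)
    (h1 : cross v a b c = false) (h2 : cross v b a c = false) (h3 : cross v c a b = false)
    (hne : ins a b c w ≠ ins a b c v) :
    ins v a b w = ins v a b c ∧ ins v b c w = ins v b c a ∧ ins v c a w = ins v c a b := by
  have H := h.chirotope
  revert hne H h1 h2 h3
  simp only [ins, cross, pos_perm h.abc, pos_perm h.abd, pos_perm h.abe, pos_perm h.acd,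
    pos_perm h.ace, pos_perm h.ade, pos_perm h.bcd, pos_perm h.bce, pos_perm h.bde,
    pos_perm h.cde]
  generalize pos a b c = abc, pos a b v = abd, pos a b w = abe, pos a c v = acd,
    pos a c w = ace, pos a v w = ade, pos b c v = bcd, pos b c w = bce, pos b v w = bde,
    pos c v w = cde
  revert abc abd abe acd ace ade bcd bce bde cde
  decide

/-- When `v` is joined to the corners of a triangle without crossing it, a point on the same side
of the triangle is separated from a corner by one of the new triangles. -/
theorem Generic₅.exists_ins_new_ne {a b c v x : Plane} (h : Generic₅ a b c v x)
    (h1 : cross v a b c = false) (h2 : cross v b a c = false) (h3 : cross v c a b = false)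
    (heq : ins a b c x = ins a b c v) :
    ins v a b x ≠ ins v a b c ∨ ins v b c x ≠ ins v b c a ∨ ins v c a x ≠ ins v c a b := by
  have H := h.chirotope
  revert heq H h1 h2 h3
  simp only [ins, cross, pos_perm h.abc, pos_perm h.abd, pos_perm h.abe, pos_perm h.acd,
    pos_perm h.ace, pos_perm h.ade, pos_perm h.bcd, pos_perm h.bce, pos_perm h.bde,
    pos_perm h.cde]
  generalize pos a b c = abc, pos a b v = abd, pos a b x = abe, pos a c v = acd,
    pos a c x = ace, pos a v x = ade, pos b c v = bcd, pos b c x = bce, pos b v x = bde,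
    pos c v x = cde
  revert abc abd abe acd ace ade bcd bce bde cde
  decide

/-- Edges into a triangle and edges leaving it on the other side from a corner do not cross. -/
theorem Generic₅.cross_eq_false_of_ins_ne {a b c v z : Plane} (h : Generic₅ a b c v z)
    (h1 : cross v a b c = false) (h2 : cross v b a c = false) (h3 : cross v c a b = false)
    (hne : ins a b c z ≠ ins a b c v) (hz : cross a z b c = false) :
    cross v b a z = false ∧ cross v c a z = false := by
  have H := h.chirotope
  revert hne H h1 h2 h3 hz
  simp only [ins, cross, pos_perm h.abc, pos_perm h.abd, pos_perm h.abe, pos_perm h.acd,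
    pos_perm h.ace, pos_perm h.ade, pos_perm h.bcd, pos_perm h.bce, pos_perm h.bde,
    pos_perm h.cde]
  generalize pos a b c = abc, pos a b v = abd, pos a b z = abe, pos a c v = acd,
    pos a c z = ace, pos a v z = ade, pos b c v = bcd, pos b c z = bce, pos b v z = bde,
    pos c v z = cde
  revert abc abd abe acd ace ade bcd bce bde cde
  decide

/-! ### Combinatorial crossing versus intersection of segments. -/

theorem area_lineMap (a b c d : Plane) (t : ℝ) :
    area a b (AffineMap.lineMap c d t) = (1 - t) * area a b c + t * area a b d := by
  simp only [area, AffineMap.lineMap_apply, vsub_eq_sub, vadd_eq_add, Prod.fst_add, Prod.snd_add,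
    Prod.smul_fst, Prod.smul_snd, Prod.fst_sub, Prod.snd_sub, smul_eq_mul]
  ring

theorem area_eq_zero_of_mem_segment {a b x : Plane} (h : x ∈ segment ℝ a b) :
    area a b x = 0 := by
  rw [segment_eq_image_lineMap] at h
  obtain ⟨t, -, rfl⟩ := h
  rw [area_lineMap]; simp only [area]; ring

/-- The area over a fixed base is affine along a segment, so a zero between two nonzero end values
forces a change of sign. -/
theorem pos_ne_of_mem_segment {a b c d x : Plane} (hc : area a b c ≠ 0) (hd : area a b d ≠ 0)
    (hx : x ∈ segment ℝ c d) (h0 : area a b x = 0) : pos a b c ≠ pos a b d := by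
  rw [segment_eq_image_lineMap] at hx
  obtain ⟨t, ⟨ht0, ht1⟩, rfl⟩ := hx
  rw [area_lineMap] at h0
  simp only [pos]
  rcases hc.lt_or_gt with hc | hc <;> rcases hd.lt_or_gt with hd | hd
  · rcases ht0.eq_or_lt with rfl | ht0
    · simp at h0; linarith
    · nlinarith [mul_neg_of_pos_of_neg ht0 hd]
  · simp [hc.not_gt, hd]
  · simp [hc, hd.not_gt]
  · rcases ht0.eq_or_lt with rfl | ht0
    · simp at h0; linarith
    · nlinarith [mul_pos ht0 hd]

theorem disjoint_segment_of_cross_eq_false {a b c d : Plane} (h1 : area a b c ≠ 0)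
    (h2 : area a b d ≠ 0) (h3 : area c d a ≠ 0) (h4 : area c d b ≠ 0)
    (h : cross a b c d = false) : Disjoint (segment ℝ a b) (segment ℝ c d) := by
  rw [Set.disjoint_left]
  intro x hx hx'
  have e1 := pos_ne_of_mem_segment h1 h2 hx' (area_eq_zero_of_mem_segment hx)
  have e2 := pos_ne_of_mem_segment h3 h4 hx (area_eq_zero_of_mem_segment hx')
  simp [cross, e1, e2] at h

theorem div_sub_mem_Icc {α β : ℝ} (hα : α ≠ 0) (hβ : β ≠ 0)
    (h : decide (0 < α) ≠ decide (0 < β)) : α - β ≠ 0 ∧ α / (α - β) ∈ Icc (0 : ℝ) 1 := by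
  rcases hα.lt_or_gt with hα | hα <;> rcases hβ.lt_or_gt with hβ | hβ
  · simp [hα.not_gt, hβ.not_gt] at h
  · have : α - β < 0 := by linarith
    exact ⟨this.ne, div_nonneg_of_nonpos hα.le this.le, (div_le_one_of_neg this).2 (by linarith)⟩
  · have : 0 < α - β := by linarith
    exact ⟨this.ne', div_nonneg hα.le this.le, (div_le_one this).2 (by linarith)⟩
  · simp [hα, hβ] at h

theorem cross_eq_false_of_disjoint_segment {a b c d : Plane} (h1 : area a b c ≠ 0)
    (h2 : area a b d ≠ 0) (h3 : area c d a ≠ 0) (h4 : area c d b ≠ 0)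
    (h : Disjoint (segment ℝ a b) (segment ℝ c d)) : cross a b c d = false := by
  by_contra hc
  simp only [cross, Bool.not_eq_false, Bool.and_eq_true, bne_iff_ne] at hc
  obtain ⟨hs, hst⟩ := div_sub_mem_Icc h1 h2 hc.1
  obtain ⟨hr, hrt⟩ := div_sub_mem_Icc h3 h4 hc.2
  rw [segment_eq_image_lineMap, segment_eq_image_lineMap] at h
  refine Set.disjoint_left.1 h (mem_image_of_mem _ hrt) ⟨_, hst, ?_⟩
  -- The quotients from `div_sub_mem_Icc` are the parameters at which each segment meets the line of
  -- the other. Both denominators are, up to sign, the cross product of the two directions, so the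
  -- two points can be compared.
  have e : area c d a - area c d b = -(area a b c - area a b d) := by
    simp only [area]; ring
  rw [e]
  have key : ∀ x y z w : ℝ, (area a b c - area a b d) * x + area a b c * (y - x) =
      (area a b c - area a b d) * z - area c d a * (w - z) →
      x + area a b c / (area a b c - area a b d) * (y - x) =
      z + area c d a / (-(area a b c - area a b d)) * (w - z) := by
    intro x y z w hh
    field_simp
    linarith
  ext
  · simp only [AffineMap.lineMap_apply, vsub_eq_sub, vadd_eq_add, Prod.fst_add,
      Prod.smul_fst, Prod.fst_sub, smul_eq_mul]
    rw [add_comm _ c.1, add_comm _ a.1]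
    apply key
    simp only [area]; ring
  · simp only [AffineMap.lineMap_apply, vsub_eq_sub, vadd_eq_add, Prod.snd_add,
      Prod.smul_snd, Prod.snd_sub, smul_eq_mul]
    rw [add_comm _ c.2, add_comm _ a.2]
    apply key
    simp only [area]; ring

/-! ### Stability and density of good positions. -/

/-- Disjointness of two segments is stable under small perturbations. -/
theorem eventually_disjoint_segment {X : Type*} [TopologicalSpace X] {x₀ : X}
    {f g h k : X → Plane} (hf : Continuous f) (hg : Continuous g) (hh : Continuous h)
    (hk : Continuous k)
    (hd : Disjoint (segment ℝ (f x₀) (g x₀)) (segment ℝ (h x₀) (k x₀))) :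
    ∀ᶠ x in 𝓝 x₀, Disjoint (segment ℝ (f x) (g x)) (segment ℝ (h x) (k x)) := by
  simp only [segment_eq_image, Set.disjoint_left] at hd ⊢
  -- Compactness of the square of parameter pairs makes the pointwise neighbourhoods uniform.
  have hK : IsCompact (Icc (0 : ℝ) 1 ×ˢ Icc (0 : ℝ) 1) := isCompact_Icc.prod isCompact_Icc
  have key : ∀ᶠ x in 𝓝 x₀, ∀ y ∈ Icc (0 : ℝ) 1 ×ˢ Icc (0 : ℝ) 1,
      (1 - y.1) • f x + y.1 • g x ≠ (1 - y.2) • h x + y.2 • k x := by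
    refine hK.eventually_forall_of_forall_eventually fun y hy => ?_
    refine ContinuousAt.eventually_ne (g := fun z : X × ℝ × ℝ =>
      (1 - z.2.1) • f z.1 + z.2.1 • g z.1 - ((1 - z.2.2) • h z.1 + z.2.2 • k z.1)) (x := (x₀, y))
      (y := 0) ?_ ?_ |>.mono fun z hz => sub_ne_zero.1 hz
    · exact Continuous.continuousAt (by fun_prop)
    · rw [sub_ne_zero]
      exact fun he => hd ⟨y.1, hy.1, rfl⟩ ⟨y.2, hy.2, he.symm⟩
  filter_upwards [key] with x hx
  rintro _ ⟨s, hs, rfl⟩ ⟨t, ht, he⟩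
  exact hx (s, t) ⟨hs, ht⟩ he.symm

theorem continuous_area {X : Type*} [TopologicalSpace X] {f g h : X → Plane}
    (hf : Continuous f) (hg : Continuous g) (hh : Continuous h) :
    Continuous fun x => area (f x) (g x) (h x) := by
  unfold area; fun_prop

/-- The points off a line are dense. -/
theorem dense_area_ne_zero {w z : Plane} (h : w ≠ z) : Dense {v | area w z v ≠ 0} := by
  intro v
  by_cases hv : area w z v = 0
  · let d : Plane := (-(z.2 - w.2), z.1 - w.1)
    have hc : Tendsto (fun t : ℝ => v + t • d) (𝓝[≠] 0) (𝓝 v) := by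
      have : Continuous fun t : ℝ => v + t • d := by fun_prop
      have := this.tendsto 0
      simp only [zero_smul, add_zero] at this
      exact this.mono_left nhdsWithin_le_nhds
    refine mem_closure_of_tendsto hc ?_
    filter_upwards [self_mem_nhdsWithin] with t ht
    have e : area w z (v + t • d) = area w z v + t * ((z.1 - w.1) ^ 2 + (z.2 - w.2) ^ 2) := by
      simp only [area, d, Prod.fst_add, Prod.snd_add, Prod.smul_fst, Prod.smul_snd, smul_eq_mul]
      ring
    simp only [e, hv, zero_add]
    refine mul_ne_zero ht fun h0 => h ?_
    have h1 : z.1 - w.1 = 0 := by nlinarith [sq_nonneg (z.1 - w.1), sq_nonneg (z.2 - w.2)]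
    have h2 : z.2 - w.2 = 0 := by nlinarith [sq_nonneg (z.1 - w.1), sq_nonneg (z.2 - w.2)]
    ext <;> linarith
  · exact subset_closure hv

theorem decide_pos_eq_beq {α β : ℝ} {σ : Bool} (h : 0 < (if σ then 1 else -1) * (α * β)) :
    decide (0 < β) = (decide (0 < α) == σ) := by
  have hα : α ≠ 0 := by rintro rfl; simp at h
  have hβ : β ≠ 0 := by rintro rfl; simp at h
  have key := decide_mul_pos hα hβ
  cases σ
  · simp only [Bool.false_eq_true, if_false, neg_mul, one_mul] at h
    rw [decide_eq_false (by linarith : ¬0 < α * β)] at key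
    revert key
    generalize decide (0 < α) = u, decide (0 < β) = v
    revert u v; decide
  · simp only [if_true, one_mul] at h
    rw [decide_eq_true h] at key
    revert key
    generalize decide (0 < α) = u, decide (0 < β) = v
    revert u v; decide

-- For σ = true the three signs describe the interior of the triangle; for σ = false they describe
-- the angle opposite to the corner a, behind it as seen from the side b c. Either region sees the
-- corners without obstruction by the triangle.
set_option synthInstance.maxHeartbeats 200000 in
set_option synthInstance.maxSize 1000 in
theorem ins_and_cross_of_pos {a b c v : Plane} (σ : Bool) (habc : area a b c ≠ 0) (h1 : area a b v ≠ 0)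
    (h2 : area a c v ≠ 0) (h3 : area b c v ≠ 0) (p1 : pos a b v = (pos a b c == σ))
    (p2 : pos c a v = (pos a b c == σ)) (p3 : pos b c v = pos a b c) :
    ins a b c v = σ ∧ cross v a b c = false ∧ cross v b a c = false ∧ cross v c a b = false := by
  revert p1 p2 p3
  simp only [ins, cross, pos_perm habc, pos_perm h1, pos_perm h2, pos_perm h3]
  generalize pos a b c = abc, pos a b v = abv, pos a c v = acv, pos b c v = bcv
  revert abc abv acv bcv σ
  decide

/-- Next to each corner of a triangle, on either side, there are points in general position that
can be joined to the corners without crossing the triangle. -/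
theorem frequently_near {a b c : Plane} (h : area a b c ≠ 0) (σ : Bool)
    {L : Set (Plane × Plane)} (hL : L.Finite) (hne : ∀ q ∈ L, q.1 ≠ q.2) :
    ∃ᶠ v in 𝓝 a, (∀ q ∈ L, area q.1 q.2 v ≠ 0) ∧ ins a b c v = σ ∧ cross v a b c = false ∧
      cross v b a c = false ∧ cross v c a b = false := by
  let s : ℝ := if σ then 1 else -1
  let W : Set Plane := {v | 0 < s * (area a b c * area a b v) ∧ 0 < s * (area a b c * area c a v) ∧
    0 < area a b c * area b c v}
  have hW : IsOpen W := by
    have h1 : Continuous fun v => area a b v :=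
      continuous_area continuous_const continuous_const continuous_id
    have h2 : Continuous fun v => area c a v :=
      continuous_area continuous_const continuous_const continuous_id
    have h3 : Continuous fun v => area b c v :=
      continuous_area continuous_const continuous_const continuous_id
    exact (isOpen_lt continuous_const (by fun_prop : Continuous fun v =>
      s * (area a b c * area a b v))).inter
      ((isOpen_lt continuous_const (by fun_prop : Continuous fun v =>
      s * (area a b c * area c a v))).inter (isOpen_lt continuous_const
      (by fun_prop : Continuous fun v => area a b c * area b c v)))
  have haW : a ∈ closure W := by
    -- Twice the vector from a to the midpoint of b c. The sign s moves into the triangle or away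
    -- from it, and t < 1/2 keeps the point on the a-side of the line b c.
    let d : Plane := (b.1 + c.1 - 2 * a.1, b.2 + c.2 - 2 * a.2)
    have hc : Tendsto (fun t : ℝ => a + (s * t) • d) (𝓝[>] 0) (𝓝 a) := by
      have : Continuous fun t : ℝ => a + (s * t) • d := by fun_prop
      have := this.tendsto 0
      simp only [mul_zero, zero_smul, add_zero] at this
      exact this.mono_left nhdsWithin_le_nhds
    refine mem_closure_of_tendsto hc ?_
    have hlt : ∀ᶠ t : ℝ in 𝓝[>] 0, t < 1 / 2 :=
      nhdsWithin_le_nhds (gt_mem_nhds (by norm_num))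
    have hs : s * s = 1 := by simp only [s]; split_ifs <;> norm_num
    have hs1 : s ≤ 1 := by simp only [s]; split_ifs <;> norm_num
    have hp : 0 < area a b c * area a b c := mul_self_pos.2 h
    filter_upwards [self_mem_nhdsWithin, hlt] with t ht ht'
    have ht : 0 < t := ht
    have e1 : area a b (a + (s * t) • d) = s * t * area a b c := by
      simp only [area, d, Prod.fst_add, Prod.snd_add, Prod.smul_fst, Prod.smul_snd, smul_eq_mul]
      ring
    have e2 : area c a (a + (s * t) • d) = s * t * area a b c := by
      simp only [area, d, Prod.fst_add, Prod.snd_add, Prod.smul_fst, Prod.smul_snd, smul_eq_mul]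
      ring
    have e3 : area b c (a + (s * t) • d) = (1 - 2 * (s * t)) * area a b c := by
      simp only [area, d, Prod.fst_add, Prod.snd_add, Prod.smul_fst, Prod.smul_snd, smul_eq_mul]
      ring
    simp only [W, mem_ofPred_eq, e1, e2, e3]
    have : s * (area a b c * (s * t * area a b c)) = t * (area a b c * area a b c) := by
      linear_combination (t * area a b c * area a b c) * hs
    rw [this]
    refine ⟨by positivity, by positivity, ?_⟩
    have : 0 < 1 - 2 * (s * t) := by nlinarith
    have := mul_pos this hp
    linarith
  -- Avoiding finitely many lines is a dense condition, so it can be met inside the open set W.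
  have hD : Dense (⋂ q ∈ L, {v | area q.1 q.2 v ≠ 0}) := by
    refine dense_biInter_of_isOpen (fun q hq => ?_) hL.countable
      fun q hq => dense_area_ne_zero (hne q hq)
    exact isOpen_ne_fun (continuous_area continuous_const continuous_const continuous_id)
      continuous_const
  have hcl := hD.open_subset_closure_inter hW
  have ha : a ∈ closure (W ∩ ⋂ q ∈ L, {v | area q.1 q.2 v ≠ 0}) :=
    closure_minimal hcl isClosed_closure haW
  refine (mem_closure_iff_frequently.1 ha).mono ?_
  rintro v ⟨⟨w1, w2, w3⟩, hv⟩
  simp only [mem_iInter, mem_ofPred_eq] at hv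
  refine ⟨hv, ?_⟩
  have n1 : area a b v ≠ 0 := by rintro h0; simp [h0] at w1
  have n2 : area c a v ≠ 0 := by rintro h0; simp [h0] at w2
  have n3 : area b c v ≠ 0 := by rintro h0; simp [h0] at w3
  refine ins_and_cross_of_pos σ h n1 (area_ne_swap n2) n3 (decide_pos_eq_beq w1)
    (decide_pos_eq_beq w2) ?_
  · simp only [pos]
    rcases h.lt_or_gt with h | h
    · simp [h.not_gt, (neg_of_mul_pos_right w3 h.le).not_gt]
    · simp [h, pos_of_mul_pos_right w3 h.le]

/-! ### Uniqueness of the labelled graph on given points. -/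

/-- The first `n` points are in general position. -/
def GeneralPos (p : ℕ → Plane) (n : ℕ) : Prop :=
  ∀ i j k : ℕ, i < n → j < n → k < n → i ≠ j → i ≠ k → j ≠ k → area (p i) (p j) (p k) ≠ 0

theorem GeneralPos.generic₅ {p : ℕ → Plane} {n : ℕ} (hp : GeneralPos p n) {a b c d e : ℕ}
    (ha : a < n) (hb : b < n) (hc : c < n) (hd : d < n) (he : e < n) (hab : a ≠ b) (hac : a ≠ c)
    (had : a ≠ d) (hae : a ≠ e) (hbc : b ≠ c) (hbd : b ≠ d) (hbe : b ≠ e) (hcd : c ≠ d)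
    (hce : c ≠ e) (hde : d ≠ e) : Generic₅ (p a) (p b) (p c) (p d) (p e) := by
  constructor <;> apply hp <;> assumption

/-- The vertices of a labelled graph on `n` vertices starting with a complete graph on four
vertices, where every later vertex `i` is joined to a set `f i` of three earlier ones. -/
structure IsAttachment (f : ℕ → Finset ℕ) (n : ℕ) : Prop where
  init : ∀ i < 4, f i = Finset.range i
  card : ∀ i, 3 ≤ i → i < n → (f i).card = 3
  subset : ∀ i, f i ⊆ Finset.range i
  -- A fixed value beyond the vertices makes equality of functions the same as equality of labelled
  -- graphs.
  eq_empty : ∀ i, n ≤ i → f i = ∅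

theorem IsAttachment.lt {f : ℕ → Finset ℕ} {n u v : ℕ} (hf : IsAttachment f n) (h : u ∈ f v) :
    u < v ∧ v < n := by
  refine ⟨Finset.mem_range.1 (hf.subset v h), ?_⟩
  by_contra hv
  simp [hf.eq_empty v (not_lt.1 hv)] at h

/-- Adjacency in the graph with lower neighbourhoods `f`. -/
def Joined (f : ℕ → Finset ℕ) (u v : ℕ) : Prop := u ∈ f v ∨ v ∈ f u

theorem Joined.symm {f : ℕ → Finset ℕ} {u v : ℕ} (h : Joined f u v) : Joined f v u := Or.symm h

/-- Edges without a common end are drawn as disjoint segments. -/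
def NonCrossing (f : ℕ → Finset ℕ) (p : ℕ → Plane) : Prop :=
  ∀ u v w z, u ∈ f v → w ∈ f z → u ≠ w → u ≠ z → v ≠ w → v ≠ z →
    Disjoint (segment ℝ (p u) (p v)) (segment ℝ (p w) (p z))

theorem NonCrossing.disjoint {f : ℕ → Finset ℕ} {p : ℕ → Plane} (h : NonCrossing f p)
    {u v w z : ℕ} (huv : Joined f u v) (hwz : Joined f w z) (h1 : u ≠ w) (h2 : u ≠ z)
    (h3 : v ≠ w) (h4 : v ≠ z) :
    Disjoint (segment ℝ (p u) (p v)) (segment ℝ (p w) (p z)) := by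
  rcases huv with huv | huv <;> rcases hwz with hwz | hwz
  · exact h u v w z huv hwz h1 h2 h3 h4
  · rw [segment_symm ℝ (p w)]; exact h u v z w huv hwz h2 h1 h4 h3
  · rw [segment_symm ℝ (p u)]; exact h v u w z huv hwz h3 h4 h1 h2
  · rw [segment_symm ℝ (p u), segment_symm ℝ (p w)]; exact h v u z w huv hwz h4 h3 h2 h1

theorem GeneralPos.cross_eq_false_iff {p : ℕ → Plane} {n : ℕ} (hp : GeneralPos p n)
    {u v w z : ℕ} (hu : u < n) (hv : v < n) (hw : w < n) (hz : z < n) (huv : u ≠ v) (h1 : u ≠ w)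
    (h2 : u ≠ z) (h3 : v ≠ w) (h4 : v ≠ z) (hwz : w ≠ z) :
    cross (p u) (p v) (p w) (p z) = false ↔
      Disjoint (segment ℝ (p u) (p v)) (segment ℝ (p w) (p z)) :=
  have a1 := hp u v w hu hv hw huv h1 h3
  have a2 := hp u v z hu hv hz huv h2 h4
  have a3 := hp w z u hw hz hu hwz h1.symm h2.symm
  have a4 := hp w z v hw hz hv hwz h3.symm h4.symm
  ⟨disjoint_segment_of_cross_eq_false a1 a2 a3 a4, cross_eq_false_of_disjoint_segment a1 a2 a3 a4⟩

/-- A vertex joined to `x` without crossing a triangle that separates `x` from all other vertices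
is a corner of the triangle. -/
theorem GeneralPos.mem_of_separating {p : ℕ → Plane} {n : ℕ} (hp : GeneralPos p n)
    {a b c w x : ℕ} (ha : a < n) (hb : b < n) (hc : c < n) (hw : w < n) (hx : x < n)
    (hab : a ≠ b) (hac : a ≠ c) (hbc : b ≠ c) (hax : a ≠ x) (hbx : b ≠ x) (hcx : c ≠ x)
    (hwx : w ≠ x)
    (hsep : w ≠ a → w ≠ b → w ≠ c →
      ins (p a) (p b) (p c) (p w) ≠ ins (p a) (p b) (p c) (p x))
    (hd : ∀ u v, u ∈ ({a, b, c} : Finset ℕ) → v ∈ ({a, b, c} : Finset ℕ) → u ≠ v →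
      w ≠ u → w ≠ v → Disjoint (segment ℝ (p w) (p x)) (segment ℝ (p u) (p v))) :
    w ∈ ({a, b, c} : Finset ℕ) := by
  by_contra hm
  simp only [Finset.mem_insert, Finset.mem_singleton, not_or] at hm
  obtain ⟨h1, h2, h3⟩ := hm
  have hG := hp.generic₅ ha hb hc hx hw hab hac hax (Ne.symm h1) hbc hbx (Ne.symm h2) hcx
    (Ne.symm h3) hwx.symm
  have hn : ∀ u v, u < n → v < n → u ≠ x → v ≠ x → u ∈ ({a, b, c} : Finset ℕ) →
      v ∈ ({a, b, c} : Finset ℕ) → u ≠ v → w ≠ u → w ≠ v →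
      cross (p w) (p x) (p u) (p v) = false := fun u v hu hv hux hvx hu' hv' huv hwu hwv =>
    (hp.cross_eq_false_iff hw hx hu hv hwx hwu hwv hux.symm hvx.symm huv).2
      (hd u v hu' hv' huv hwu hwv)
  rcases hG.cross_of_ins_ne (hsep h1 h2 h3) with h | h | h
  · rw [hn a b ha hb hax hbx (by simp) (by simp) hab h1 h2] at h; cases h
  · rw [hn b c hb hc hbx hcx (by simp) (by simp) hbc h2 h3] at h; cases h
  · rw [hn c a hc ha hcx hax (by simp) (by simp) hac.symm h3 h1] at h; cases h

theorem joined_of_mem {f : ℕ → Finset ℕ} {a b c u v : ℕ} (hab : Joined f a b)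
    (hbc : Joined f b c) (hca : Joined f c a) (hu : u ∈ ({a, b, c} : Finset ℕ))
    (hv : v ∈ ({a, b, c} : Finset ℕ)) (huv : u ≠ v) : Joined f u v := by
  simp only [Finset.mem_insert, Finset.mem_singleton] at hu hv
  rcases hu with rfl | rfl | rfl <;> rcases hv with rfl | rfl | rfl <;>
    first
    | exact absurd rfl huv
    | assumption
    | (apply Joined.symm; assumption)

/-- In a straight-line drawing, each later point is separated from all earlier vertices by a
triangle of the graph on the earlier vertices. -/
theorem exists_separating {f : ℕ → Finset ℕ} {p : ℕ → Plane} {n : ℕ} (hf : IsAttachment f n)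
    (hp : GeneralPos p n) (hN : NonCrossing f p) (i : ℕ) (h3 : 3 ≤ i) :
    ∀ x, i ≤ x → x < n → ∃ a b c, a < i ∧ b < i ∧ c < i ∧ a ≠ b ∧ a ≠ c ∧ b ≠ c ∧
      Joined f a b ∧ Joined f b c ∧ Joined f c a ∧
      ∀ w < i, w ≠ a → w ≠ b → w ≠ c →
        ins (p a) (p b) (p c) (p w) ≠ ins (p a) (p b) (p c) (p x) := by
  induction i, h3 using Nat.le_induction with
  | base =>
    intro x _ _
    refine ⟨0, 1, 2, by norm_num, by norm_num, by norm_num, by norm_num, by norm_num,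
      by norm_num, ?_, ?_, ?_, ?_⟩
    · left; simp [hf.init 1]
    · left; simp [hf.init 2]
    · right; simp [hf.init 2]
    · intro w hw; omega
  | succ i h3 ih =>
    intro x hix hx
    obtain ⟨a, b, c, ha, hb, hc, hab, hac, hbc, jab, jbc, jca, hsep⟩ := ih x (by omega) hx
    -- If the old triangle has x and i on different sides, it still works. Otherwise it separates i
    -- from the earlier vertices as well, and one of the three triangles at i takes its place.
    by_cases heq : ins (p a) (p b) (p c) (p x) = ins (p a) (p b) (p c) (p i)
    swap
    · refine ⟨a, b, c, by omega, by omega, by omega, hab, hac, hbc, jab, jbc, jca, ?_⟩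
      intro w hw h1 h2 h3
      rcases Nat.lt_succ_iff_lt_or_eq.1 hw with hw | rfl
      · exact hsep w hw h1 h2 h3
      · exact Ne.symm heq
    rw [heq] at hsep
    have hi : i < n := by omega
    -- A lower neighbour of i that is not a corner would need an edge crossing the triangle.
    have hsub : f i ⊆ {a, b, c} := by
      intro w hw
      have hwi := (hf.lt hw).1
      refine hp.mem_of_separating (x := i) (by omega) (by omega) (by omega) (by omega) hi hab hac
        hbc ha.ne hb.ne hc.ne hwi.ne (hsep w hwi) fun u v hu hv huv hwu hwv => ?_
      have hlt : ∀ y ∈ ({a, b, c} : Finset ℕ), i ≠ y := by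
        intro y hy
        simp only [Finset.mem_insert, Finset.mem_singleton] at hy
        omega
      exact hN.disjoint (Or.inl hw) (joined_of_mem jab jbc jca hu hv huv) hwu hwv (hlt u hu)
        (hlt v hv)
    have hfi : f i = {a, b, c} := Finset.eq_of_subset_of_card_le hsub (by
      rw [hf.card i h3 hi]; exact Finset.card_le_three)
    have ja : Joined f i a := Or.inr (by simp [hfi])
    have jb : Joined f i b := Or.inr (by simp [hfi])
    have jc : Joined f i c := Or.inr (by simp [hfi])
    have c1 : cross (p i) (p a) (p b) (p c) = false :=
      (hp.cross_eq_false_iff hi (by omega) (by omega) (by omega) ha.ne' hb.ne' hc.ne' hab hac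
        hbc).2 (hN.disjoint ja jbc hb.ne' hc.ne' hab hac)
    have c2 : cross (p i) (p b) (p a) (p c) = false :=
      (hp.cross_eq_false_iff hi (by omega) (by omega) (by omega) hb.ne' ha.ne' hc.ne' hab.symm hbc
        hac).2 (hN.disjoint jb jca.symm ha.ne' hc.ne' hab.symm hbc)
    have c3 : cross (p i) (p c) (p a) (p b) = false :=
      (hp.cross_eq_false_iff hi (by omega) (by omega) (by omega) hc.ne' ha.ne' hb.ne' hac.symm
        hbc.symm hab).2 (hN.disjoint jc jab ha.ne' hb.ne' hac.symm hbc.symm)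
    have hG : ∀ y, y < n → a ≠ y → b ≠ y → c ≠ y → i ≠ y →
        Generic₅ (p a) (p b) (p c) (p i) (p y) := fun y hy h1 h2 h3 h4 =>
      hp.generic₅ (by omega) (by omega) (by omega) hi hy hab hac ha.ne h1 hbc hb.ne h2 hc.ne h3 h4
    -- No earlier vertex is separated from the missing corner by a new triangle, so it is enough to
    -- separate x from that corner.
    have hnew : ∀ w < i, w ≠ a → w ≠ b → w ≠ c →
        ins (p i) (p a) (p b) (p w) = ins (p i) (p a) (p b) (p c) ∧
        ins (p i) (p b) (p c) (p w) = ins (p i) (p b) (p c) (p a) ∧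
        ins (p i) (p c) (p a) (p w) = ins (p i) (p c) (p a) (p b) := fun w hw h1 h2 h3 =>
      (hG w (by omega) h1.symm h2.symm h3.symm hw.ne').ins_new_eq c1 c2 c3 (hsep w hw h1 h2 h3)
    rcases (hG x hx (by omega) (by omega) (by omega) (by omega)).exists_ins_new_ne c1 c2 c3 heq
      with h | h | h
    · refine ⟨i, a, b, by omega, by omega, by omega, ha.ne', hb.ne', hab, ja, jab, jb.symm, ?_⟩
      intro w hw h1 h2 h3
      have hw : w < i := by omega
      by_cases hwc : w = c
      · subst hwc; exact h.symm
      · rw [(hnew w hw h2 h3 hwc).1]; exact h.symm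
    · refine ⟨i, b, c, by omega, by omega, by omega, hb.ne', hc.ne', hbc, jb, jbc, jc.symm, ?_⟩
      intro w hw h1 h2 h3
      have hw : w < i := by omega
      by_cases hwc : w = a
      · subst hwc; exact h.symm
      · rw [(hnew w hw hwc h2 h3).2.1]; exact h.symm
    · refine ⟨i, c, a, by omega, by omega, by omega, hc.ne', ha.ne', hac.symm, jc, jca, ja.symm,
        ?_⟩
      intro w hw h1 h2 h3
      have hw : w < i := by omega
      by_cases hwc : w = b
      · subst hwc; exact h.symm
      · rw [(hnew w hw h3 hwc h2).2.2]; exact h.symm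

/-- A labelled point set in general position carries at most one labelled graph of this kind. -/
theorem IsAttachment.eq_of_nonCrossing {f g : ℕ → Finset ℕ} {p : ℕ → Plane} {n : ℕ}
    (hf : IsAttachment f n) (hg : IsAttachment g n) (hp : GeneralPos p n)
    (hNf : NonCrossing f p) (hNg : NonCrossing g p) : f = g := by
  have key : ∀ i, f i = g i := by
    intro i
    induction i using Nat.strong_induction_on with
    | _ i ih =>
      by_cases h4 : i < 4
      · rw [hf.init i h4, hg.init i h4]
      by_cases hi : i < n
      swap
      · rw [hf.eq_empty i (by omega), hg.eq_empty i (by omega)]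
      obtain ⟨a, b, c, ha, hb, hc, hab, hac, hbc, jab, jbc, jca, hsep⟩ :=
        exists_separating hf hp hNf i (by omega) i le_rfl hi
      -- Below i the two graphs agree by induction, so the separating triangle found for f is a
      -- triangle of g too.
      have hj : ∀ u v, u < i → v < i → Joined f u v → Joined g u v := by
        intro u v hu hv h
        simpa only [Joined, ih u hu, ih v hv] using h
      have main : ∀ h : ℕ → Finset ℕ, IsAttachment h n → NonCrossing h p → Joined h a b →
          Joined h b c → Joined h c a → h i = {a, b, c} := by
        intro h hh hN jab jbc jca
        refine Finset.eq_of_subset_of_card_le ?_ (by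
          rw [hh.card i (by omega) hi]; exact Finset.card_le_three)
        intro w hw
        have hwi := (hh.lt hw).1
        refine hp.mem_of_separating (x := i) (by omega) (by omega) (by omega) (by omega) hi hab
          hac hbc ha.ne hb.ne hc.ne hwi.ne (hsep w hwi) fun u v hu hv huv hwu hwv => ?_
        have hlt : ∀ y ∈ ({a, b, c} : Finset ℕ), i ≠ y := by
          intro y hy
          simp only [Finset.mem_insert, Finset.mem_singleton] at hy
          omega
        exact hN.disjoint (Or.inl hw) (joined_of_mem jab jbc jca hu hv huv) hwu hwv (hlt u hu)
          (hlt v hv)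
      rw [main f hf hNf jab jbc jca, main g hg hNg (hj a b ha hb jab) (hj b c hb hc jbc)
        (hj c a hc ha jca)]
  exact funext key

/-! ### Stacked triangulations and their straight-line drawings. -/

/-- The faces obtained from the faces `Φ` by stacking the vertex `i` onto the face `F`. -/
def stackFaces (Φ : Finset (Finset ℕ)) (F : Finset ℕ) (i : ℕ) : Finset (Finset ℕ) :=
  Φ.erase F ∪ F.image fun a => insert i (F.erase a)

/-- The lower neighbourhoods of the complete graph on four vertices. -/
def completeFour (i : ℕ) : Finset ℕ := if i < 4 then Finset.range i else ∅

/-- `f` and `Φ` are the lower neighbourhoods and the faces of a stacked triangulation on `n`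
vertices, labelled in the order of stacking. -/
inductive Stacked : ℕ → (ℕ → Finset ℕ) → Finset (Finset ℕ) → Prop
  | base : Stacked 4 completeFour (Finset.powersetCard 3 (Finset.range 4))
  | step {n : ℕ} {f : ℕ → Finset ℕ} {Φ : Finset (Finset ℕ)} {F : Finset ℕ}
      (h : Stacked n f Φ) (hF : F ∈ Φ) :
      Stacked (n + 1) (Function.update f n F) (stackFaces Φ F n)

/-- `a b c` are the corners of the face `F`, and all other vertices are on one side of it. -/
structure IsFace (f : ℕ → Finset ℕ) (p : ℕ → Plane) (n : ℕ) (F : Finset ℕ) (a b c : ℕ)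
    (s : Bool) : Prop where
  eq : F = {a, b, c}
  lt₁ : a < n
  lt₂ : b < n
  lt₃ : c < n
  ne₁₂ : a ≠ b
  ne₁₃ : a ≠ c
  ne₂₃ : b ≠ c
  joined₁₂ : Joined f a b
  joined₂₃ : Joined f b c
  joined₃₁ : Joined f c a
  side : ∀ w < n, w ≠ a → w ≠ b → w ≠ c → ins (p a) (p b) (p c) (p w) = s

theorem IsFace.card {f : ℕ → Finset ℕ} {p : ℕ → Plane} {n : ℕ} {F : Finset ℕ} {a b c : ℕ}
    {s : Bool} (h : IsFace f p n F a b c s) : F.card = 3 := by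
  rw [h.eq]; exact Finset.card_eq_three.2 ⟨a, b, c, h.ne₁₂, h.ne₁₃, h.ne₂₃, rfl⟩

theorem IsFace.subset_range {f : ℕ → Finset ℕ} {p : ℕ → Plane} {n : ℕ} {F : Finset ℕ}
    {a b c : ℕ} {s : Bool} (h : IsFace f p n F a b c s) : F ⊆ Finset.range n := by
  rw [h.eq]
  intro y hy
  simp only [Finset.mem_insert, Finset.mem_singleton] at hy
  have := h.lt₁; have := h.lt₂; have := h.lt₃
  rw [Finset.mem_range]; omega

/-- `p` is a straight-line drawing with faces `Φ`. -/
structure IsDrawing (n : ℕ) (f : ℕ → Finset ℕ) (Φ : Finset (Finset ℕ)) (p : ℕ → Plane) :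
    Prop where
  attach : IsAttachment f n
  general : GeneralPos p n
  nonCrossing : NonCrossing f p
  face : ∀ F ∈ Φ, ∃ a b c s, IsFace f p n F a b c s

theorem IsAttachment.update {f : ℕ → Finset ℕ} {n : ℕ} {F : Finset ℕ} (hn : 4 ≤ n)
    (hf : IsAttachment f n) (h3 : F.card = 3) (hF : F ⊆ Finset.range n) :
    IsAttachment (Function.update f n F) (n + 1) where
  init i hi := by rw [Function.update_of_ne (by omega)]; exact hf.init i hi
  card i h hi := by
    by_cases hin : i = n
    · subst hin; simpa using h3
    · rw [Function.update_of_ne hin]; exact hf.card i h (by omega)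
  subset i := by
    by_cases hin : i = n
    · subst hin; simpa using hF
    · rw [Function.update_of_ne hin]; exact hf.subset i
  eq_empty i hi := by rw [Function.update_of_ne (by omega)]; exact hf.eq_empty i (by omega)

theorem Joined.update {f : ℕ → Finset ℕ} {n u v : ℕ} {F : Finset ℕ} (h : Joined f u v)
    (hu : u < n) (hv : v < n) : Joined (Function.update f n F) u v := by
  unfold Joined
  rwa [Function.update_of_ne hu.ne, Function.update_of_ne hv.ne]

/-- Stacking a vertex in a suitable position onto a face of a drawing. -/
theorem IsDrawing.step {n : ℕ} {f : ℕ → Finset ℕ} {Φ : Finset (Finset ℕ)} {q : ℕ → Plane}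
    (hn : 4 ≤ n) (hD : IsDrawing n f Φ q) (hq : GeneralPos q (n + 1)) {F : Finset ℕ}
    {a b c : ℕ} {s : Bool} (hF : IsFace f q n F a b c s)
    (hside : ins (q a) (q b) (q c) (q n) ≠ s)
    (c1 : cross (q n) (q a) (q b) (q c) = false) (c2 : cross (q n) (q b) (q a) (q c) = false)
    (c3 : cross (q n) (q c) (q a) (q b) = false)
    (hnear : ∀ u ∈ F, ∀ w z, w ∈ f z → u ≠ w → u ≠ z → a ≠ w → a ≠ z →
      Disjoint (segment ℝ (q u) (q n)) (segment ℝ (q w) (q z))) :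
    IsDrawing (n + 1) (Function.update f n F) (stackFaces Φ F n) q := by
  have hf := hD.attach
  have hN := hD.nonCrossing
  have hf' := hf.update hn hF.card hF.subset_range
  have ha := hF.lt₁; have hb := hF.lt₂; have hc := hF.lt₃
  have hab := hF.ne₁₂; have hac := hF.ne₁₃; have hbc := hF.ne₂₃
  have hG : ∀ y, y < n → a ≠ y → b ≠ y → c ≠ y → Generic₅ (q a) (q b) (q c) (q n) (q y) :=
    fun y hy h1 h2 h3 => hq.generic₅ (by omega) (by omega) (by omega) (by omega) (by omega) hab
      hac ha.ne h1 hbc hb.ne h2 hc.ne h3 hy.ne'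
  -- Edges at a cannot be treated by perturbation, as the new point lies close to a. They are
  -- handled by signs: apart from b and c, their far ends are across the triangle from the new
  -- point.
  have hcorner : ∀ y, Joined f a y → (b ≠ y → Disjoint (segment ℝ (q b) (q n))
      (segment ℝ (q a) (q y))) ∧ (c ≠ y → Disjoint (segment ℝ (q c) (q n))
      (segment ℝ (q a) (q y))) := by
    intro y hy
    have hyn : y < n := by
      rcases hy with h | h
      · exact (hf.lt h).2
      · exact (hf.lt h).1.trans ha
    have hay : a ≠ y := by
      rcases hy with h | h
      · exact (hf.lt h).1.ne
      · exact (hf.lt h).1.ne'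
    have goal : (b ≠ y → cross (q n) (q b) (q a) (q y) = false) ∧
        (c ≠ y → cross (q n) (q c) (q a) (q y) = false) := by
      by_cases hyb : b = y
      · subst hyb; exact ⟨fun h => absurd rfl h, fun _ => c3⟩
      by_cases hyc : c = y
      · subst hyc; exact ⟨fun _ => c2, fun h => absurd rfl h⟩
      have hz : cross (q a) (q y) (q b) (q c) = false :=
        (hD.general.cross_eq_false_iff ha hyn hb hc hay hab hac (Ne.symm hyb) (Ne.symm hyc) hbc).2
          (hN.disjoint hy hF.joined₂₃ hab hac (Ne.symm hyb) (Ne.symm hyc))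
      have := (hG y hyn hay hyb hyc).cross_eq_false_of_ins_ne c1 c2 c3
        (by rw [hF.side y hyn hay.symm (Ne.symm hyb) (Ne.symm hyc)]; exact hside.symm) hz
      exact ⟨fun _ => this.1, fun _ => this.2⟩
    refine ⟨fun h => ?_, fun h => ?_⟩
    · rw [segment_symm ℝ (q b)]
      exact (hq.cross_eq_false_iff (by omega) (by omega) (by omega) (by omega) hb.ne' ha.ne'
        hyn.ne' hab.symm h hay).1 (goal.1 h)
    · rw [segment_symm ℝ (q c)]
      exact (hq.cross_eq_false_iff (by omega) (by omega) (by omega) (by omega) hc.ne' ha.ne'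
        hyn.ne' hac.symm h hay).1 (goal.2 h)
  have hnew : ∀ u ∈ F, ∀ w z, w ∈ f z → u ≠ w → u ≠ z →
      Disjoint (segment ℝ (q u) (q n)) (segment ℝ (q w) (q z)) := by
    intro u hu w z hwz huw huz
    by_cases haw : a = w
    · subst haw
      have := hcorner z (Or.inl hwz)
      rw [hF.eq] at hu
      simp only [Finset.mem_insert, Finset.mem_singleton] at hu
      rcases hu with rfl | rfl | rfl
      · exact absurd rfl huw
      · exact this.1 huz
      · exact this.2 huz
    by_cases haz : a = z
    · subst haz
      have := hcorner w (Or.inr hwz)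
      rw [segment_symm ℝ (q w)]
      rw [hF.eq] at hu
      simp only [Finset.mem_insert, Finset.mem_singleton] at hu
      rcases hu with rfl | rfl | rfl
      · exact absurd rfl huz
      · exact this.1 huw
      · exact this.2 huw
    exact hnear u hu w z hwz huw huz haw haz
  have hN' : NonCrossing (Function.update f n F) q := by
    intro u v w z huv hwz h1 h2 h3 h4
    by_cases hv : v = n
    · subst hv
      rw [Function.update_self] at huv
      rw [Function.update_of_ne h4.symm] at hwz
      exact hnew u huv w z hwz h1 h2
    · rw [Function.update_of_ne hv] at huv
      by_cases hz : z = n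
      · subst hz
        rw [Function.update_self] at hwz
        exact (hnew w hwz u v huv h1.symm h3.symm).symm
      · rw [Function.update_of_ne hz] at hwz
        exact hN u v w z huv hwz h1 h2 h3 h4
  have hins : ∀ w < n, w ≠ a → w ≠ b → w ≠ c →
      ins (q n) (q a) (q b) (q w) = ins (q n) (q a) (q b) (q c) ∧
      ins (q n) (q b) (q c) (q w) = ins (q n) (q b) (q c) (q a) ∧
      ins (q n) (q c) (q a) (q w) = ins (q n) (q c) (q a) (q b) := fun w hw h1 h2 h3 =>
    (hG w hw h1.symm h2.symm h3.symm).ins_new_eq c1 c2 c3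
      (by rw [hF.side w hw h1 h2 h3]; exact hside.symm)
  have jn : ∀ u ∈ F, Joined (Function.update f n F) n u := fun u hu => Or.inr (by simpa using hu)
  have jna := jn a (by simp [hF.eq])
  have jnb := jn b (by simp [hF.eq])
  have jnc := jn c (by simp [hF.eq])
  refine ⟨hf', hq, hN', fun T hT => ?_⟩
  rw [stackFaces, Finset.mem_union, Finset.mem_image] at hT
  rcases hT with hT | ⟨y, hy, rfl⟩
  · obtain ⟨hTF, hT⟩ := Finset.mem_erase.1 hT
    obtain ⟨d, e, g, s', h⟩ := hD.face T hT
    have hd := h.lt₁; have he := h.lt₂; have hg := h.lt₃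
    refine ⟨d, e, g, s', h.eq, by omega, by omega, by omega, h.ne₁₂, h.ne₁₃, h.ne₂₃, h.joined₁₂.update h.lt₁ h.lt₂,
      h.joined₂₃.update h.lt₂ h.lt₃, h.joined₃₁.update h.lt₃ h.lt₁, ?_⟩
    intro w hw h1 h2 h3
    rcases Nat.lt_succ_iff_lt_or_eq.1 hw with hw | rfl
    · exact h.side w hw h1 h2 h3
    -- If an old face T ≠ F had the new vertex on its empty side, it would separate it from the
    -- other vertices; then every corner of F would be a corner of T, forcing F = T.
    by_contra hne
    refine hTF (Finset.eq_of_subset_of_card_le ?_ (by rw [hF.card, h.card])).symm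
    intro u hu
    have huw := Finset.mem_range.1 (hF.subset_range hu)
    rw [h.eq]
    refine hq.mem_of_separating (x := w) (by omega) (by omega) (by omega) (by omega) hw h.ne₁₂
      h.ne₁₃ h.ne₂₃ h1.symm h2.symm h3.symm huw.ne (fun g1 g2 g3 => ?_)
      fun x y hx hy hxy hux huy => ?_
    · rw [h.side u huw g1 g2 g3]; exact Ne.symm hne
    · rcases joined_of_mem h.joined₁₂ h.joined₂₃ h.joined₃₁ hx hy hxy with hj | hj
      · exact hnew u hu x y hj hux huy
      · rw [segment_symm ℝ (q x)]
        exact hnew u hu y x hj huy hux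
  · rw [hF.eq] at hy
    simp only [Finset.mem_insert, Finset.mem_singleton] at hy
    rcases hy with rfl | rfl | rfl
    · refine ⟨n, b, c, ins (q n) (q b) (q c) (q y), ?_, by omega, by omega, by omega, hb.ne',
        hc.ne', hbc, jnb, hF.joined₂₃.update hb hc, jnc.symm, ?_⟩
      · rw [hF.eq, Finset.erase_insert (by simp [hab, hac])]
      · intro w hw h1 h2 h3
        by_cases hwc : w = y
        · rw [hwc]
        · exact (hins w (by omega) hwc h2 h3).2.1
    · refine ⟨n, c, a, ins (q n) (q c) (q a) (q y), ?_, by omega, by omega, by omega, hc.ne',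
        ha.ne', hac.symm, jnc, hF.joined₃₁.update hc ha, jna.symm, ?_⟩
      · rw [hF.eq]
        ext t
        simp only [Finset.mem_insert, Finset.mem_erase, Finset.mem_singleton]
        grind
      · intro w hw h1 h2 h3
        by_cases hwc : w = y
        · rw [hwc]
        · exact (hins w (by omega) h3 hwc h2).2.2
    · refine ⟨n, a, b, ins (q n) (q a) (q b) (q y), ?_, by omega, by omega, by omega, ha.ne',
        hb.ne', hab, jna, hF.joined₁₂.update ha hb, jnb.symm, ?_⟩
      · rw [hF.eq]
        ext t
        simp only [Finset.mem_insert, Finset.mem_erase, Finset.mem_singleton]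
        grind
      · intro w hw h1 h2 h3
        by_cases hwc : w = y
        · rw [hwc]
        · exact (hins w (by omega) h2 h3 hwc).1

theorem GeneralPos.ne {p : ℕ → Plane} {n : ℕ} (hp : GeneralPos p n) (hn : 3 ≤ n) {i j : ℕ}
    (hi : i < n) (hj : j < n) (hij : i ≠ j) : p i ≠ p j := by
  obtain ⟨k, hk, hki, hkj⟩ : ∃ k < n, i ≠ k ∧ j ≠ k := by
    by_cases h0 : i = 0 ∨ j = 0
    · by_cases h1 : i = 1 ∨ j = 1
      · exact ⟨2, by omega, by omega, by omega⟩
      · exact ⟨1, by omega, by omega, by omega⟩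
    · exact ⟨0, by omega, by omega, by omega⟩
  intro h
  refine hp i j k hi hj hk hij hki hkj ?_
  simp only [area, h]; ring

theorem not_mem_segment_of_area_ne {a b x : Plane} (h : area a b x ≠ 0) : x ∉ segment ℝ a b :=
  fun hx => h (area_eq_zero_of_mem_segment hx)

/-- Only the first n positions matter, which leaves position n free for the next vertex. -/
theorem IsDrawing.congr {n : ℕ} {f : ℕ → Finset ℕ} {Φ : Finset (Finset ℕ)} {p q : ℕ → Plane}
    (h : IsDrawing n f Φ p) (hpq : ∀ i < n, q i = p i) : IsDrawing n f Φ q where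
  attach := h.attach
  general i j k hi hj hk := by
    rw [hpq i hi, hpq j hj, hpq k hk]; exact h.general i j k hi hj hk
  nonCrossing u v w z huv hwz := by
    have h1 := h.attach.lt huv
    have h2 := h.attach.lt hwz
    rw [hpq u (by omega), hpq v (by omega), hpq w (by omega), hpq z (by omega)]
    exact h.nonCrossing u v w z huv hwz
  face F hF := by
    obtain ⟨a, b, c, s, hh⟩ := h.face F hF
    refine ⟨a, b, c, s, hh.eq, hh.lt₁, hh.lt₂, hh.lt₃, hh.ne₁₂, hh.ne₁₃, hh.ne₂₃, hh.joined₁₂,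
      hh.joined₂₃, hh.joined₃₁, fun w hw => ?_⟩
    rw [hpq a hh.lt₁, hpq b hh.lt₂, hpq c hh.lt₃, hpq w hw]
    exact hh.side w hw

/-- A vertex can be stacked onto any face of a drawing. -/
theorem IsDrawing.exists_step {n : ℕ} {f : ℕ → Finset ℕ} {Φ : Finset (Finset ℕ)} {p : ℕ → Plane}
    (hn : 4 ≤ n) (hD : IsDrawing n f Φ p) {F : Finset ℕ} (hF : F ∈ Φ) :
    ∃ q, IsDrawing (n + 1) (Function.update f n F) (stackFaces Φ F n) q := by
  obtain ⟨a, b, c, s, hface⟩ := hD.face F hF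
  have ha := hface.lt₁; have hb := hface.lt₂; have hc := hface.lt₃
  have hp := hD.general
  let L : Set (Plane × Plane) :=
    (fun x : ℕ × ℕ => (p x.1, p x.2)) '' {x | x.1 < n ∧ x.2 < n ∧ x.1 ≠ x.2}
  have hLfin : L.Finite := by
    refine Set.Finite.image _ (((Set.finite_Iio n).prod (Set.finite_Iio n)).subset ?_)
    rintro ⟨x, y⟩ ⟨h1, h2, -⟩
    exact ⟨h1, h2⟩
  have hLne : ∀ x ∈ L, x.1 ≠ x.2 := by
    rintro _ ⟨⟨x, y⟩, ⟨h1, h2, h3⟩, rfl⟩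
    exact hp.ne (by omega) h1 h2 h3
  -- At v = p a the segment from u is the edge u a, or a single point if u = a. It is disjoint from
  -- every edge avoiding both u and a, and stays so for v near p a.
  have hev : ∀ᶠ v in 𝓝 (p a), ∀ u ∈ F, ∀ z ∈ Finset.range n, ∀ w ∈ f z,
      u ≠ w → u ≠ z → a ≠ w → a ≠ z →
      Disjoint (segment ℝ (p u) v) (segment ℝ (p w) (p z)) := by
    refine (Finset.eventually_all F).2 fun u hu => (Finset.eventually_all _).2 fun z _ =>
      (Finset.eventually_all _).2 fun w hw => ?_
    by_cases hc : u ≠ w ∧ u ≠ z ∧ a ≠ w ∧ a ≠ z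
    swap
    · exact Filter.Eventually.of_forall fun v h1 h2 h3 h4 => absurd ⟨h1, h2, h3, h4⟩ hc
    obtain ⟨h1, h2, h3, h4⟩ := hc
    have hwz := hD.attach.lt hw
    refine (eventually_disjoint_segment (x₀ := p a) continuous_const continuous_id
      continuous_const continuous_const ?_).mono fun v hv _ _ _ _ => hv
    by_cases hua : u = a
    · subst hua
      simp only [id, segment_same, Set.disjoint_singleton_left]
      exact not_mem_segment_of_area_ne
        (hp w z u (by omega) (by omega) ha (by omega) h1.symm h2.symm)
    · have hj : Joined f u a := joined_of_mem hface.joined₁₂ hface.joined₂₃ hface.joined₃₁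
        (by rwa [← hface.eq]) (by simp) hua
      exact hD.nonCrossing.disjoint hj (Or.inl hw) h1 h2 h3 h4
  -- The value `!s` selects the empty side of the face, which is the outside when the other vertices
  -- lie inside.
  obtain ⟨v, ⟨hvL, hvs, k1, k2, k3⟩, hv⟩ := ((frequently_near
    (hp a b c ha hb hc hface.ne₁₂ hface.ne₁₃ hface.ne₂₃) (!s) hLfin hLne).and_eventually hev).exists
  have hvL' : ∀ x y, x < n → y < n → x ≠ y → area (p x) (p y) v ≠ 0 := fun x y hx hy hxy =>
    hvL _ ⟨(x, y), ⟨hx, hy, hxy⟩, rfl⟩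
  let q := Function.update p n v
  have hq : ∀ i < n, q i = p i := fun i hi => Function.update_of_ne hi.ne _ _
  have hqn : q n = v := Function.update_self _ _ _
  have hgen : GeneralPos q (n + 1) := by
    intro i j k hi hj hk hij hik hjk
    by_cases hkn : k = n
    · rw [hkn, hqn, hq i (by omega), hq j (by omega)]
      exact hvL' i j (by omega) (by omega) hij
    by_cases hjn : j = n
    · rw [hjn, hqn, hq i (by omega), hq k (by omega)]
      exact area_ne_rotate (hvL' k i (by omega) (by omega) hik.symm)
    by_cases hin : i = n
    · rw [hin, hqn, hq j (by omega), hq k (by omega)]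
      exact area_ne_rotate (area_ne_rotate (hvL' j k (by omega) (by omega) hjk))
    · rw [hq i (by omega), hq j (by omega), hq k (by omega)]
      exact hp i j k (by omega) (by omega) (by omega) hij hik hjk
  have hface' : IsFace f q n F a b c s := ⟨hface.eq, ha, hb, hc, hface.ne₁₂, hface.ne₁₃,
    hface.ne₂₃, hface.joined₁₂, hface.joined₂₃, hface.joined₃₁, fun w hw => by
      rw [hq a ha, hq b hb, hq c hc, hq w hw]; exact hface.side w hw⟩
  refine ⟨q, (hD.congr hq).step hn hgen hface' ?_ ?_ ?_ ?_ ?_⟩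
  · rw [hq a ha, hq b hb, hq c hc, hqn, hvs]; simp
  · rwa [hq a ha, hq b hb, hq c hc, hqn]
  · rwa [hq a ha, hq b hb, hq c hc, hqn]
  · rwa [hq a ha, hq b hb, hq c hc, hqn]
  · intro u hu w z hwz h1 h2 h3 h4
    have hlt := hD.attach.lt hwz
    rw [hq u (Finset.mem_range.1 (hface.subset_range hu)), hqn, hq w (by omega), hq z hlt.2]
    exact hv u hu z (Finset.mem_range.2 hlt.2) w hwz h1 h2 h3 h4

theorem exists_isDrawing_completeFour :
    ∃ p, IsDrawing 4 completeFour (Finset.powersetCard 3 (Finset.range 4)) p := by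
  -- A triangle with the last point in its interior.
  let p : ℕ → Plane := fun i =>
    if i = 0 then (0, 0) else if i = 1 then (3, 0) else if i = 2 then (0, 3) else (1, 1)
  have hp : GeneralPos p 4 := by
    intro i j k hi hj hk hij hik hjk
    interval_cases i <;> interval_cases j <;> first | exact absurd rfl hij | skip
    all_goals interval_cases k <;> first | exact absurd rfl hik | exact absurd rfl hjk | skip
    all_goals norm_num [p, area]
  have hf : IsAttachment completeFour 4 := by
    refine ⟨fun i hi => by simp [completeFour, hi], fun i h3 h4 => ?_, fun i => ?_, fun i hi => ?_⟩
    · simp only [completeFour, h4, if_true, Finset.card_range]; omega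
    · unfold completeFour; split_ifs <;> simp
    · simp [completeFour, hi]
  refine ⟨p, hf, hp, fun u v w z huv hwz h1 h2 h3 h4 => ?_, fun F hF => ?_⟩
  · have a1 := hf.lt huv
    have a2 := hf.lt hwz
    refine (hp.cross_eq_false_iff (by omega) (by omega) (by omega) (by omega) (by omega) h1 h2 h3
      h4 (by omega)).1 ?_
    obtain ⟨a1, a3⟩ := a1
    obtain ⟨a2, a4⟩ := a2
    clear huv hwz
    have : u < 4 := by omega
    have : w < 4 := by omega
    interval_cases v <;> interval_cases u <;> interval_cases z <;> interval_cases w <;>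
      first
      | omega
      | norm_num [p, cross, pos, area]
  · obtain ⟨hsub, hcard⟩ := Finset.mem_powersetCard.1 hF
    obtain ⟨a, b, c, hab, hac, hbc, rfl⟩ := Finset.card_eq_three.1 hcard
    have ha : a < 4 := Finset.mem_range.1 (hsub (by simp))
    have hb : b < 4 := Finset.mem_range.1 (hsub (by simp))
    have hc : c < 4 := Finset.mem_range.1 (hsub (by simp))
    have hj : ∀ u v, u < 4 → v < 4 → u ≠ v → Joined completeFour u v := by
      intro u v hu hv huv
      simp only [Joined, completeFour, hu, hv, if_true, Finset.mem_range]
      omega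
    refine ⟨a, b, c, ins (p a) (p b) (p c) (p (6 - a - b - c)), rfl, ha, hb, hc, hab, hac, hbc,
      hj a b ha hb hab, hj b c hb hc hbc, hj c a hc ha hac.symm, fun w hw h1 h2 h3 => ?_⟩
    -- The labels 0, 1, 2, 3 sum to 6, so this is the only vertex off the face.
    rw [show w = 6 - a - b - c by omega]

theorem Stacked.four_le {n : ℕ} {f : ℕ → Finset ℕ} {Φ : Finset (Finset ℕ)}
    (h : Stacked n f Φ) : 4 ≤ n := by
  induction h with
  | base => rfl
  | step _ _ ih => omega

/-- Every stacked triangulation has a straight-line drawing in general position. -/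
theorem Stacked.exists_isDrawing {n : ℕ} {f : ℕ → Finset ℕ} {Φ : Finset (Finset ℕ)}
    (h : Stacked n f Φ) : ∃ p, IsDrawing n f Φ p := by
  induction h with
  | base => exact exists_isDrawing_completeFour
  | step h hF ih =>
    obtain ⟨p, hp⟩ := ih
    exact hp.exists_step h.four_le hF

theorem Stacked.isAttachment {n : ℕ} {f : ℕ → Finset ℕ} {Φ : Finset (Finset ℕ)}
    (h : Stacked n f Φ) : IsAttachment f n := by
  obtain ⟨p, hp⟩ := h.exists_isDrawing
  exact hp.attach

theorem Stacked.face_card {n : ℕ} {f : ℕ → Finset ℕ} {Φ : Finset (Finset ℕ)}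
    (h : Stacked n f Φ) {F : Finset ℕ} (hF : F ∈ Φ) : F.card = 3 ∧ F ⊆ Finset.range n := by
  obtain ⟨p, hp⟩ := h.exists_isDrawing
  obtain ⟨a, b, c, s, hf⟩ := hp.face F hF
  exact ⟨hf.card, hf.subset_range⟩

/-! ### Counting labelled stacked triangulations. -/

theorem Stacked.card_faces {n : ℕ} {f : ℕ → Finset ℕ} {Φ : Finset (Finset ℕ)}
    (h : Stacked n f Φ) : Φ.card = 2 * (n - 2) := by
  induction h with
  | base => simp [Finset.card_powersetCard]
  | @step n f Φ F h hF ih =>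
    have h4 := h.four_le
    obtain ⟨hF3, hFn⟩ := h.face_card hF
    have hnF : ∀ T ∈ Φ, n ∉ T := fun T hT hn => by
      simpa using (h.face_card hT).2 hn
    -- The new faces contain n and the old ones do not; as the three new ones are distinct, stacking
    -- adds exactly two faces.
    have hdisj : Disjoint (Φ.erase F) (F.image fun a => insert n (F.erase a)) := by
      rw [Finset.disjoint_left]
      intro T hT hT'
      obtain ⟨a, -, rfl⟩ := Finset.mem_image.1 hT'
      exact hnF _ (Finset.mem_of_mem_erase hT) (Finset.mem_insert_self _ _)
    have hinj : Set.InjOn (fun a => insert n (F.erase a)) F := by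
      intro a ha b hb hab
      by_contra hne
      have hmem : a ∈ insert n (F.erase b) :=
        Finset.mem_insert_of_mem (Finset.mem_erase.2 ⟨hne, ha⟩)
      rw [← show insert n (F.erase a) = insert n (F.erase b) from hab] at hmem
      rcases Finset.mem_insert.1 hmem with h1 | h1
      · exact hnF F hF (h1 ▸ ha)
      · simp at h1
    have hpos : 0 < Φ.card := Finset.card_pos.2 ⟨F, hF⟩
    rw [stackFaces, Finset.card_union_of_disjoint hdisj, Finset.card_image_of_injOn hinj,
      Finset.card_erase_of_mem hF, hF3, ih]
    omega

/-- There are `2 ^ (n - 4) * (n - 3)!` labelled stacked triangulations on `n` vertices. -/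
theorem exists_stacked_finset (n : ℕ) (hn : 4 ≤ n) :
    ∃ S : Finset ((ℕ → Finset ℕ) × Finset (Finset ℕ)), (∀ s ∈ S, Stacked n s.1 s.2) ∧
      Set.InjOn Prod.fst (S : Set ((ℕ → Finset ℕ) × Finset (Finset ℕ))) ∧
      S.card = 2 ^ (n - 4) * (n - 3).factorial := by
  classical
  induction n, hn using Nat.le_induction with
  | base =>
    refine ⟨{(completeFour, Finset.powersetCard 3 (Finset.range 4))}, ?_, ?_, by simp⟩
    · intro s hs
      rw [Finset.mem_singleton] at hs
      subst hs
      exact Stacked.base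
    · rw [Finset.coe_singleton]; exact Set.injOn_singleton _ _
  | succ n hn ih =>
    obtain ⟨S, hS, hinj, hcard⟩ := ih
    let e : (Σ _ : (ℕ → Finset ℕ) × Finset (Finset ℕ), Finset ℕ) →
        (ℕ → Finset ℕ) × Finset (Finset ℕ) :=
      fun x => (Function.update x.1.1 n x.2, stackFaces x.1.2 x.2 n)
    -- The value at n recovers the chosen face. The other values recover the predecessor, whose own
    -- value at n was ∅.
    have he : ∀ x ∈ S.sigma (fun s => s.2), ∀ y ∈ S.sigma (fun s => s.2),
        (e x).1 = (e y).1 → x = y := by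
      rintro ⟨s, F⟩ hx ⟨t, T⟩ hy hxy
      obtain ⟨hs, hF⟩ := Finset.mem_sigma.1 hx
      obtain ⟨ht, hT⟩ := Finset.mem_sigma.1 hy
      have hFT : F = T := by simpa [e] using congrFun hxy n
      have hst : s.1 = t.1 := by
        funext i
        by_cases hi : i = n
        · rw [(hS s hs).isAttachment.eq_empty i hi.ge, (hS t ht).isAttachment.eq_empty i hi.ge]
        · simpa [e, Function.update_of_ne hi] using congrFun hxy i
      have := hinj hs ht hst
      subst this hFT
      rfl
    refine ⟨(S.sigma fun s => s.2).image e, ?_, ?_, ?_⟩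
    · intro s hs
      obtain ⟨⟨t, F⟩, hx, rfl⟩ := Finset.mem_image.1 hs
      obtain ⟨ht, hF⟩ := Finset.mem_sigma.1 hx
      exact (hS t ht).step hF
    · intro s hs t ht hst
      obtain ⟨x, hx, rfl⟩ := Finset.mem_image.1 hs
      obtain ⟨y, hy, rfl⟩ := Finset.mem_image.1 ht
      rw [he x hx y hy hst]
    · rw [Finset.card_image_of_injOn fun x hx y hy hxy => he x hx y hy (congrArg Prod.fst hxy),
        Finset.card_sigma, Finset.sum_congr rfl fun s hs => (hS s hs).card_faces,
        Finset.sum_const, hcard, smul_eq_mul, show n + 1 - 4 = n - 4 + 1 by omega,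
        show n + 1 - 3 = n - 3 + 1 by omega, Nat.factorial_succ, pow_succ,
        show n - 3 + 1 = n - 2 by omega]
      ring

/-! ### Straight-line embeddings and order types. -/

/-- The graph on `n` vertices with given lower neighbourhoods. -/
def stackGraph (f : ℕ → Finset ℕ) (n : ℕ) : SimpleGraph (Fin n) :=
  SimpleGraph.fromRel fun u v => (u : ℕ) ∈ f v

theorem IsAttachment.stackGraph_adj {f : ℕ → Finset ℕ} {n : ℕ} (hf : IsAttachment f n)
    {u v : Fin n} : (stackGraph f n).Adj u v ↔ Joined f u v := by
  rw [stackGraph, SimpleGraph.fromRel_adj, Joined]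
  refine ⟨fun h => h.2, fun h => ⟨?_, h⟩⟩
  rintro rfl
  rcases h with h | h <;> exact lt_irrefl _ (hf.lt h).1

/-- The points are in general position. -/
def InGeneralPos {n : ℕ} (p : Fin n → Plane) : Prop :=
  ∀ i j k : Fin n, i ≠ j → i ≠ k → j ≠ k → area (p i) (p j) (p k) ≠ 0

theorem eq_of_mem_segment {a b c x : Plane} (h : area a b c ≠ 0) (h1 : x ∈ segment ℝ a b)
    (h2 : x ∈ segment ℝ a c) : x = a := by
  have h0 := area_eq_zero_of_mem_segment h1
  rw [segment_eq_image_lineMap] at h2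
  obtain ⟨t, -, rfl⟩ := h2
  rw [area_lineMap, show area a b a = 0 by simp only [area]; ring, mul_zero, zero_add] at h0
  rw [(mul_eq_zero.1 h0).resolve_right h, AffineMap.lineMap_apply_zero]

theorem straightArc_mk {V : Type*} (p : V → Plane) (u v : V) :
    straightArc p s(u, v) = segment ℝ (p u) (p v) := rfl

theorem IsStraightLineEmbedding.disjoint_segment {V : Type*} {G : SimpleGraph V} {p : V → Plane}
    (h : IsStraightLineEmbedding G p) {u v w z : V} (huv : G.Adj u v) (hwz : G.Adj w z)
    (h1 : u ≠ w) (h2 : u ≠ z) (h3 : v ≠ w) (h4 : v ≠ z) :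
    Disjoint (segment ℝ (p u) (p v)) (segment ℝ (p w) (p z)) := by
  rw [Set.disjoint_left]
  intro x hx hx'
  obtain ⟨t, ⟨ht, ht'⟩, -⟩ := h.edge_inter s(u, v) huv s(w, z) hwz (by
    intro he
    rcases Sym2.eq_iff.1 he with ⟨e, -⟩ | ⟨e, -⟩
    · exact h1 e
    · exact h2 e) ⟨hx, hx'⟩
  rw [Sym2.mem_iff] at ht ht'
  rcases ht with rfl | rfl <;> rcases ht' with h | h <;> contradiction

/-- A foreign vertex on an edge, or two edges with a common end meeting elsewhere, would give three
collinear points. General position leaves only pairs of edges without a common end to check. -/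
theorem isStraightLineEmbedding_iff {n : ℕ} {G : SimpleGraph (Fin n)} {p : Fin n → Plane}
    (hinj : Function.Injective p) (hp : InGeneralPos p) :
    IsStraightLineEmbedding G p ↔ ∀ u v w z, G.Adj u v → G.Adj w z → u ≠ w → u ≠ z → v ≠ w →
      v ≠ z → Disjoint (segment ℝ (p u) (p v)) (segment ℝ (p w) (p z)) := by
  constructor
  · exact fun h u v w z huv hwz h1 h2 h3 h4 => h.disjoint_segment huv hwz h1 h2 h3 h4
  · intro h
    refine ⟨hinj, fun e => ?_, fun e => ?_⟩
    · induction e using Sym2.ind with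
      | _ u v =>
        intro huv w hw
        by_contra hm
        rw [Sym2.mem_iff, not_or] at hm
        exact hp u v w (G.ne_of_adj huv) (Ne.symm hm.1) (Ne.symm hm.2)
          (area_eq_zero_of_mem_segment hw)
    · induction e using Sym2.ind with
      | _ u v =>
        intro huv f
        induction f using Sym2.ind with
        | _ w z =>
          intro hwz hne x hx
          obtain ⟨hx, hx'⟩ := hx
          rw [straightArc_mk] at hx hx'
          have huv' : u ≠ v := G.ne_of_adj huv
          have hwz' : w ≠ z := G.ne_of_adj hwz
          by_cases h1 : u = w
          · subst h1
            have hvz : v ≠ z := by rintro rfl; exact hne rfl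
            exact ⟨u, by simp, (eq_of_mem_segment (hp u v z huv' hwz' hvz) hx hx').symm⟩
          by_cases h2 : u = z
          · subst h2
            have hvz : v ≠ w := by rintro rfl; exact hne Sym2.eq_swap
            rw [segment_symm] at hx'
            exact ⟨u, by simp, (eq_of_mem_segment (hp u v w huv' h1 hvz) hx hx').symm⟩
          by_cases h3 : v = w
          · subst h3
            rw [segment_symm] at hx
            exact ⟨v, by simp, (eq_of_mem_segment (hp v u z huv'.symm hwz' h2) hx hx').symm⟩
          by_cases h4 : v = z
          · subst h4
            rw [segment_symm] at hx hx'
            exact ⟨v, by simp, (eq_of_mem_segment (hp v u w huv'.symm hwz'.symm h1) hx hx').symm⟩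
          exact absurd hx' (Set.disjoint_left.1 (h u v w z huv hwz h1 h2 h3 h4) hx)

theorem orient_eq_sign_area (a b c : Plane) : orient a b c = SignType.sign (area a b c) := by
  rw [orient, Matrix.det_fin_three]
  congr 1
  simp [area]
  ring

theorem pos_eq_of_orient_eq {a b c a' b' c' : Plane} (h : orient a b c = orient a' b' c') :
    pos a b c = pos a' b' c' := by
  rw [orient_eq_sign_area, orient_eq_sign_area] at h
  rw [pos, pos, decide_eq_decide, ← sign_eq_one_iff, ← sign_eq_one_iff, h]

theorem area_eq_zero_iff_of_orient_eq {a b c a' b' c' : Plane}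
    (h : orient a b c = orient a' b' c') : area a b c = 0 ↔ area a' b' c' = 0 := by
  rw [orient_eq_sign_area, orient_eq_sign_area] at h
  rw [← sign_eq_zero_iff, h, sign_eq_zero_iff]

theorem InGeneralPos.comp {n : ℕ} {p : Fin n → Plane} (hp : InGeneralPos p)
    {π : Fin n → Fin n} (hπ : Function.Injective π) : InGeneralPos (p ∘ π) :=
  fun _ _ _ h1 h2 h3 => hp _ _ _ (hπ.ne h1) (hπ.ne h2) (hπ.ne h3)

/-- Straight-line embeddings only depend on the labelled order type. -/
theorem IsStraightLineEmbedding.of_orient_eq {n : ℕ} {G : SimpleGraph (Fin n)}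
    {p q : Fin n → Plane} (hp : InGeneralPos p) (hqi : Function.Injective q)
    (h : ∀ i j k, orient (p i) (p j) (p k) = orient (q i) (q j) (q k))
    (hG : IsStraightLineEmbedding G p) : IsStraightLineEmbedding G q := by
  have hq : InGeneralPos q := fun i j k h1 h2 h3 h0 =>
    hp i j k h1 h2 h3 ((area_eq_zero_iff_of_orient_eq (h i j k)).2 h0)
  rw [isStraightLineEmbedding_iff hG.injective hp] at hG
  rw [isStraightLineEmbedding_iff hqi hq]
  intro u v w z huv hwz h1 h2 h3 h4
  have huv' := G.ne_of_adj huv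
  have hwz' := G.ne_of_adj hwz
  have := cross_eq_false_of_disjoint_segment (hp u v w huv' h1 h3) (hp u v z huv' h2 h4)
    (hp w z u hwz' h1.symm h2.symm) (hp w z v hwz' h3.symm h4.symm) (hG u v w z huv hwz h1 h2 h3 h4)
  refine disjoint_segment_of_cross_eq_false (hq u v w huv' h1 h3) (hq u v z huv' h2 h4)
    (hq w z u hwz' h1.symm h2.symm) (hq w z v hwz' h3.symm h4.symm) ?_
  rw [← this]
  simp only [cross, pos_eq_of_orient_eq (h _ _ _)]

theorem area_eq_zero_iff_collinear {a b c : Plane} (hab : a ≠ b) :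
    area a b c = 0 ↔ Collinear ℝ {a, b, c} := by
  rw [collinear_iff_of_mem (p₀ := a) (by simp)]
  constructor
  · intro h
    refine ⟨b - a, ?_⟩
    simp only [Set.mem_insert_iff, Set.mem_singleton_iff, forall_eq_or_imp, forall_eq]
    refine ⟨⟨0, by simp⟩, ⟨1, by simp⟩, ?_⟩
    simp only [area] at h
    by_cases h1 : b.1 - a.1 = 0
    · have h2 : b.2 - a.2 ≠ 0 := fun h2 => hab (by ext <;> linarith)
      refine ⟨(c.2 - a.2) / (b.2 - a.2), ?_⟩
      have h3 : c.1 - a.1 = 0 := by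
        rw [h1, zero_mul, zero_sub, neg_eq_zero] at h
        exact (mul_eq_zero.1 h).resolve_left h2
      ext
      · simp [h1]; linarith
      · simp; field_simp; ring
    · refine ⟨(c.1 - a.1) / (b.1 - a.1), ?_⟩
      ext
      · simp; field_simp; ring
      · simp; field_simp; linarith
  · rintro ⟨v, hv⟩
    simp only [Set.mem_insert_iff, Set.mem_singleton_iff, forall_eq_or_imp, forall_eq] at hv
    obtain ⟨-, ⟨r, rfl⟩, ⟨s, rfl⟩⟩ := hv
    simp [area]; ring

theorem SimpleLabelledPointSet.inGeneralPos {n : ℕ} (P : SimpleLabelledPointSet n) :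
    InGeneralPos P.point := fun i j k h1 h2 h3 h =>
  P.general i j k h1 h2 h3 ((area_eq_zero_iff_collinear (P.injective.ne h1)).1 h)

/-- Points in general position as a simple labelled point set. -/
def InGeneralPos.toSimple {n : ℕ} {p : Fin n → Plane} (hp : InGeneralPos p)
    (hi : Function.Injective p) : SimpleLabelledPointSet n where
  point := p
  injective := hi
  general i j k h1 h2 h3 h :=
    hp i j k h1 h2 h3 ((area_eq_zero_iff_collinear (hi.ne h1)).2 h)

/-- Extension of a finite sequence of points. -/
noncomputable def extendPoints {n : ℕ} (p : Fin n → Plane) (i : ℕ) : Plane :=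
  -- The default is harmless: general position and the edges only involve labels below n.
  if h : i < n then p ⟨i, h⟩ else 0

theorem extendPoints_of_lt {n : ℕ} (p : Fin n → Plane) {i : ℕ} (hi : i < n) :
    extendPoints p i = p ⟨i, hi⟩ := by
  simp [extendPoints, hi]

theorem InGeneralPos.extend {n : ℕ} {p : Fin n → Plane} (hp : InGeneralPos p) :
    GeneralPos (extendPoints p) n := by
  intro i j k hi hj hk h1 h2 h3
  rw [extendPoints_of_lt p hi, extendPoints_of_lt p hj, extendPoints_of_lt p hk]
  exact hp _ _ _ (by simpa using h1) (by simpa using h2) (by simpa using h3)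

theorem IsAttachment.nonCrossing_of_isStraightLineEmbedding {f : ℕ → Finset ℕ} {n : ℕ}
    (hf : IsAttachment f n) {p : Fin n → Plane} (hp : InGeneralPos p)
    (h : IsStraightLineEmbedding (stackGraph f n) p) : NonCrossing f (extendPoints p) := by
  rw [isStraightLineEmbedding_iff h.injective hp] at h
  intro u v w z huv hwz h1 h2 h3 h4
  obtain ⟨hu, hv⟩ := hf.lt huv
  obtain ⟨hw, hz⟩ := hf.lt hwz
  rw [extendPoints_of_lt p (hu.trans hv), extendPoints_of_lt p hv,
    extendPoints_of_lt p (hw.trans hz), extendPoints_of_lt p hz]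
  exact h _ _ _ _ (hf.stackGraph_adj.2 (Or.inl huv)) (hf.stackGraph_adj.2 (Or.inl hwz))
    (by simpa using h1) (by simpa using h2) (by simpa using h3) (by simpa using h4)

/-- A labelled point set in general position carries at most one labelled stacked
triangulation. -/
theorem IsAttachment.eq_of_isStraightLineEmbedding {f g : ℕ → Finset ℕ} {n : ℕ}
    (hf : IsAttachment f n) (hg : IsAttachment g n) {p : Fin n → Plane} (hp : InGeneralPos p)
    (h : IsStraightLineEmbedding (stackGraph f n) p)
    (h' : IsStraightLineEmbedding (stackGraph g n) p) : f = g :=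
  hf.eq_of_nonCrossing hg hp.extend (hf.nonCrossing_of_isStraightLineEmbedding hp h)
    (hg.nonCrossing_of_isStraightLineEmbedding hp h')

theorem Stacked.exists_isStraightLineEmbedding {n : ℕ} {f : ℕ → Finset ℕ}
    {Φ : Finset (Finset ℕ)} (h : Stacked n f Φ) :
    ∃ p : Fin n → Plane, InGeneralPos p ∧ IsStraightLineEmbedding (stackGraph f n) p := by
  obtain ⟨p, hp⟩ := h.exists_isDrawing
  have h4 := h.four_le
  have hg : InGeneralPos fun i : Fin n => p i := fun i j k h1 h2 h3 =>
    hp.general i j k i.2 j.2 k.2 (by simpa [Fin.ext_iff] using h1)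
      (by simpa [Fin.ext_iff] using h2) (by simpa [Fin.ext_iff] using h3)
  refine ⟨fun i => p i, hg, (isStraightLineEmbedding_iff (fun i j hij => ?_) hg).2 ?_⟩
  · by_contra hne
    exact hp.general.ne (by omega) i.2 j.2 (by simpa [Fin.ext_iff] using hne) hij
  · intro u v w z huv hwz h1 h2 h3 h4
    rw [hp.attach.stackGraph_adj] at huv hwz
    exact hp.nonCrossing.disjoint huv hwz (by simpa [Fin.ext_iff] using h1)
      (by simpa [Fin.ext_iff] using h2) (by simpa [Fin.ext_iff] using h3)
      (by simpa [Fin.ext_iff] using h4)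

theorem IsStraightLineEmbedding.isPlanar {V : Type*} {G : SimpleGraph V} {p : V → Plane}
    (h : IsStraightLineEmbedding G p) : IsPlanar G := by
  refine ⟨p, straightArc p, fun u v huv => ?_, h⟩
  have hne : p u ≠ p v := h.injective.ne (G.ne_of_adj huv)
  refine ⟨⟨⟨fun t => AffineMap.lineMap (p u) (p v) (t : ℝ), by fun_prop⟩, by simp, by simp⟩, ?_, ?_⟩
  · intro s t hst
    exact Subtype.ext (AffineMap.lineMap_injective ℝ hne hst)
  · rw [straightArc_mk, segment_eq_image_lineMap]
    ext x
    constructor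
    · rintro ⟨t, rfl⟩
      exact ⟨t, t.2, rfl⟩
    · rintro ⟨t, ht, rfl⟩
      exact ⟨⟨t, ht⟩, rfl⟩

/-! ### Perturbation into general position. -/

theorem eventually_quadratic_ne_zero {A B C : ℝ} (hC : C ≠ 0) :
    ∀ᶠ t : ℝ in 𝓝[≠] 0, A + B * t + C * t ^ 2 ≠ 0 := by
  -- Near 0 the lowest nonvanishing coefficient decides; a power of t is factored out when A = 0.
  have hcont : ∀ D E F : ℝ, D ≠ 0 → ∀ᶠ t : ℝ in 𝓝[≠] 0, D + E * t + F * t ^ 2 ≠ 0 := by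
    intro D E F hD
    have hc : Continuous fun t : ℝ => D + E * t + F * t ^ 2 := by fun_prop
    exact (hc.continuousAt.eventually_ne (by simpa using hD)).filter_mono nhdsWithin_le_nhds
  by_cases hA : A = 0
  swap
  · exact hcont A B C hA
  by_cases hB : B = 0
  · filter_upwards [self_mem_nhdsWithin] with t ht
    simp only [hA, hB, zero_mul, zero_add]
    exact mul_ne_zero hC (pow_ne_zero 2 ht)
  · filter_upwards [self_mem_nhdsWithin, hcont B C 0 hB] with t ht h
    rw [show A + B * t + C * t ^ 2 = t * (B + C * t + 0 * t ^ 2) by rw [hA]; ring]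
    exact mul_ne_zero ht h

/-- Every sequence of points can be perturbed into general position. -/
theorem frequently_inGeneralPos {n : ℕ} (p : Fin n → Plane) : ∃ᶠ q in 𝓝 p, InGeneralPos q := by
  -- On the parabola every triple has a nonzero Vandermonde determinant as its area. This is the
  -- leading coefficient, in t, of the area of the corresponding triple of p + t m.
  let m : Fin n → Plane := fun i => ((i : ℝ), (i : ℝ) ^ 2)
  have hc : Tendsto (fun t : ℝ => p + t • m) (𝓝[≠] 0) (𝓝 p) := by
    have : Continuous fun t : ℝ => p + t • m := by fun_prop
    have := this.tendsto 0
    simp only [zero_smul, add_zero] at this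
    exact this.mono_left nhdsWithin_le_nhds
  refine hc.frequently (Eventually.frequently ?_)
  unfold InGeneralPos
  simp only [eventually_all]
  intro i j k hij hik hjk
  have hne : ∀ {x y : Fin n}, x ≠ y → (y : ℝ) - (x : ℝ) ≠ 0 := by
    intro x y hxy h
    apply hxy
    have : (y : ℝ) = (x : ℝ) := by linarith
    exact Fin.ext (by exact_mod_cast this.symm)
  have hC : area (m i) (m j) (m k) ≠ 0 := by
    have : area (m i) (m j) (m k) =
        ((j : ℝ) - (i : ℝ)) * ((k : ℝ) - (i : ℝ)) * ((k : ℝ) - (j : ℝ)) := by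
      simp only [area, m]; ring
    rw [this]
    exact mul_ne_zero (mul_ne_zero (hne hij) (hne hik)) (hne hjk)
  let B : ℝ := ((p j).1 - (p i).1) * ((m k).2 - (m i).2) + ((m j).1 - (m i).1) *
    ((p k).2 - (p i).2) - ((p j).2 - (p i).2) * ((m k).1 - (m i).1) - ((m j).2 - (m i).2) *
    ((p k).1 - (p i).1)
  filter_upwards [eventually_quadratic_ne_zero (A := area (p i) (p j) (p k)) (B := B) hC] with t ht
  convert ht using 1
  simp only [area, B, Pi.add_apply, Pi.smul_apply, Prod.fst_add, Prod.snd_add, Prod.smul_fst,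
    Prod.smul_snd, smul_eq_mul]
  ring

theorem eventually_injective {n : ℕ} {p : Fin n → Plane} (hp : Function.Injective p) :
    ∀ᶠ q in 𝓝 p, Function.Injective q := by
  have : ∀ᶠ q in 𝓝 p, ∀ i j : Fin n, i ≠ j → q i ≠ q j := by
    simp only [eventually_all]
    intro i j hij
    exact (isOpen_ne_fun (continuous_apply i) (continuous_apply j)).mem_nhds (hp.ne hij)
  filter_upwards [this] with q hq i j hij
  by_contra hne
  exact hq i j hne hij

/-- Straight-line embeddings are stable under small perturbations into general position. -/
theorem IsStraightLineEmbedding.eventually {n : ℕ} {G : SimpleGraph (Fin n)} {p : Fin n → Plane}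
    {π : Fin n → Fin n} (hπ : Function.Injective π) (h : IsStraightLineEmbedding G (p ∘ π)) :
    ∀ᶠ q in 𝓝 p, InGeneralPos q → Function.Injective q → IsStraightLineEmbedding G (q ∘ π) := by
  have : ∀ᶠ q in 𝓝 p, ∀ u v w z, G.Adj u v → G.Adj w z → u ≠ w → u ≠ z → v ≠ w → v ≠ z →
      Disjoint (segment ℝ (q (π u)) (q (π v))) (segment ℝ (q (π w)) (q (π z))) := by
    simp only [eventually_all]
    intro u v w z huv hwz h1 h2 h3 h4
    exact eventually_disjoint_segment (continuous_apply _) (continuous_apply _)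
      (continuous_apply _) (continuous_apply _) (h.disjoint_segment huv hwz h1 h2 h3 h4)
  filter_upwards [this] with q hq hg hi
  exact (isStraightLineEmbedding_iff (hi.comp hπ) (hg.comp hπ)).2 hq

/-! ### The averaging argument and the conflict collection. -/

/-- If every element of `X` is related to at most `D` elements of `T`, then some element of `T` is
related to at most the fraction `D / #T` of `X`. -/
theorem exists_card_filter_mul_le {τ γ : Type*} (R : τ → γ → Prop) [∀ t g, Decidable (R t g)]
    (X : Finset τ) (T : Finset γ) (hT : T.Nonempty) (D : ℕ)
    (hD : ∀ t ∈ X, (T.filter (R t)).card ≤ D) :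
    ∃ g ∈ T, (X.filter fun t => R t g).card * T.card ≤ X.card * D := by
  by_contra! hc
  have h1 : ∑ g ∈ T, (X.filter fun t => R t g).card = ∑ t ∈ X, (T.filter (R t)).card := by
    simp only [Finset.card_filter]
    exact Finset.sum_comm
  have h2 : ∑ t ∈ X, (T.filter (R t)).card ≤ X.card * D := by
    rw [← smul_eq_mul]
    exact Finset.sum_le_card_nsmul X _ D hD
  have h3 := Finset.sum_lt_sum_of_nonempty hT hc
  rw [Finset.sum_const, ← Finset.sum_mul, h1, smul_eq_mul, mul_comm] at h3
  exact absurd h3 (Nat.mul_le_mul_right T.card h2).not_gt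

/-- A small set of elements of `T` such that no element of `X` is related to all of them. -/
theorem exists_small_unrelated {τ γ : Type*} [DecidableEq γ] (R : τ → γ → Prop)
    [∀ t g, Decidable (R t g)] (T : Finset γ) (D : ℕ) (k : ℕ) :
    ∀ X : Finset τ, (∀ t ∈ X, (T.filter (R t)).card ≤ D) → X.card * D ^ k < T.card ^ k →
      ∃ 𝒢 ⊆ T, 𝒢.card ≤ k ∧ ∀ t ∈ X, ∃ g ∈ 𝒢, ¬R t g := by
  induction k with
  | zero =>
    intro X _ h
    have hX : X = ∅ := by simpa using h
    exact ⟨∅, by simp, by simp, by simp [hX]⟩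
  | succ k ih =>
    intro X hD h
    have hT : T.Nonempty := by
      rw [Finset.nonempty_iff_ne_empty]
      rintro rfl
      simp at h
    obtain ⟨g, hg, hle⟩ := exists_card_filter_mul_le R X T hT D hD
    -- Only the elements of X still related to g remain to be excluded. As T is unchanged, the
    -- degree bound D persists.
    obtain ⟨𝒢, h𝒢, hcard, hun⟩ := ih (X.filter fun t => R t g)
      (fun t ht => hD t (Finset.mem_of_mem_filter t ht)) (by
        refine lt_of_mul_lt_mul_right (a := T.card) ?_ (Nat.zero_le _)
        calc (X.filter fun t => R t g).card * D ^ k * T.card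
            = (X.filter fun t => R t g).card * T.card * D ^ k := by ring
          _ ≤ X.card * D * D ^ k := Nat.mul_le_mul_right _ hle
          _ = X.card * D ^ (k + 1) := by ring
          _ < T.card ^ (k + 1) := h
          _ = T.card ^ k * T.card := by ring)
    refine ⟨insert g 𝒢, Finset.insert_subset hg h𝒢,
      (Finset.card_insert_le _ _).trans (by omega), fun t ht => ?_⟩
    by_cases hR : R t g
    · obtain ⟨g', hg', h'⟩ := hun t (Finset.mem_filter.2 ⟨ht, hR⟩)
      exact ⟨g', Finset.mem_insert_of_mem hg', h'⟩
    · exact ⟨g, Finset.mem_insert_self _ _, hR⟩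

/-- A representative of a labelled order type. -/
noncomputable def SimpleLabelledOrderType.rep {n : ℕ} (t : SimpleLabelledOrderType n) :
    SimpleLabelledPointSet n := Quotient.out t

theorem SimpleLabelledOrderType.orient_rep {n : ℕ} (P : SimpleLabelledPointSet n) (i j k : Fin n) :
    orient (P.point i) (P.point j) (P.point k) =
      orient ((SimpleLabelledOrderType.rep (Quotient.mk _ P)).point i)
        ((SimpleLabelledOrderType.rep (Quotient.mk _ P)).point j)
        ((SimpleLabelledOrderType.rep (Quotient.mk _ P)).point k) :=
  (Quotient.exact (Quotient.out_eq (Quotient.mk (isomorphySetoid n) P)) i j k).symm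

/-- An embedding on labelled points in general position gives one on the representative of their
order type. -/
theorem IsStraightLineEmbedding.rep {n : ℕ} {G : SimpleGraph (Fin n)} {q : Fin n → Plane}
    (hg : InGeneralPos q) (hi : Function.Injective q) {π : Fin n → Fin n}
    (hπ : Function.Injective π) (h : IsStraightLineEmbedding G (q ∘ π)) :
    IsStraightLineEmbedding G
      ((SimpleLabelledOrderType.rep (Quotient.mk _ (hg.toSimple hi))).point ∘ π) :=
  h.of_orient_eq (hg.comp hπ) ((SimpleLabelledPointSet.injective _).comp hπ) fun i j k =>
    SimpleLabelledOrderType.orient_rep (hg.toSimple hi) (π i) (π j) (π k)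

/-- Simultaneously embeddable graphs can be embedded on common points in general position, one of
them according to its labels. -/
theorem SimultaneouslyEmbeddable.exists_rep {n : ℕ} {𝒢 : Finset (SimpleGraph (Fin n))}
    (h : SimultaneouslyEmbeddable 𝒢) {G₀ : SimpleGraph (Fin n)} (h₀ : G₀ ∈ 𝒢) :
    ∃ t : SimpleLabelledOrderType n, IsStraightLineEmbedding G₀ t.rep.point ∧
      ∀ G ∈ 𝒢, ∃ π : Equiv.Perm (Fin n), IsStraightLineEmbedding G (t.rep.point ∘ π) := by
  obtain ⟨P, hP, hG⟩ := h
  -- The embedding of G₀ is a bijection onto the n common points and serves as their labelling;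
  -- every other embedding then differs from it by a permutation.
  obtain ⟨p, hpP, hp⟩ := hG G₀ h₀
  have hsurj : ∀ x ∈ P, ∃ i, p i = x := by
    intro x hx
    have := Finset.eq_of_subset_of_card_le (s := Finset.univ.image p) (t := P)
      (by intro y hy; obtain ⟨i, -, rfl⟩ := Finset.mem_image.1 hy; exact hpP i)
      (by rw [Finset.card_image_of_injective _ hp.injective, hP]; simp)
    rw [← this] at hx
    obtain ⟨i, -, hi⟩ := Finset.mem_image.1 hx
    exact ⟨i, hi⟩
  have hperm : ∀ G ∈ 𝒢, ∃ π : Equiv.Perm (Fin n), IsStraightLineEmbedding G (p ∘ π) := by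
    intro G hGm
    obtain ⟨q, hqP, hq⟩ := hG G hGm
    choose σ hσ using fun i => hsurj (q i) (hqP i)
    have hinj : Function.Injective σ := fun i j hij => hq.injective (by
      rw [← hσ i, ← hσ j, hij])
    refine ⟨Equiv.ofBijective σ (Finite.injective_iff_bijective.1 hinj), ?_⟩
    have : p ∘ (Equiv.ofBijective σ (Finite.injective_iff_bijective.1 hinj)) = q := funext hσ
    rwa [this]
  choose! π hπ using hperm
  have hev : ∀ᶠ q in 𝓝 p, ∀ G ∈ 𝒢, InGeneralPos q → Function.Injective q →
      IsStraightLineEmbedding G (q ∘ π G) :=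
    (Finset.eventually_all 𝒢).2 fun G hG => (hπ G hG).eventually (π G).injective
  have hev₀ : ∀ᶠ q in 𝓝 p, InGeneralPos q → Function.Injective q →
      IsStraightLineEmbedding G₀ (q ∘ id) :=
    IsStraightLineEmbedding.eventually Function.injective_id hp
  obtain ⟨q, hq, h1, h2, hi⟩ := ((frequently_inGeneralPos p).and_eventually
    (hev.and (hev₀.and (eventually_injective hp.injective)))).exists
  exact ⟨Quotient.mk _ (hq.toSimple hi), (h2 hq hi).rep hq hi Function.injective_id,
    fun G hG => ⟨π G, (h1 G hG hq hi).rep hq hi (π G).injective⟩⟩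

/-- A conflict collection of size `k + 1` found by counting. -/
theorem exists_conflictCollection (n : ℕ) (hn : 4 ≤ n) :
    ∃ M : ℕ, 0 < M ∧ M * (2 ^ (n - 4) * (n - 3).factorial) ≤ numSimpleOrderTypes n ∧
      ∀ k : ℕ, M * n.factorial ^ k < (2 ^ (n - 4) * (n - 3).factorial) ^ k →
        ∃ 𝒢 : Finset (SimpleGraph (Fin n)), IsConflictCollection 𝒢 ∧ 𝒢.card ≤ k + 1 := by
  classical
  obtain ⟨S, hS, hSinj, hScard⟩ := exists_stacked_finset n hn
  let T : Finset (ℕ → Finset ℕ) := S.image Prod.fst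
  have hTcard : T.card = 2 ^ (n - 4) * (n - 3).factorial := by
    rw [← hScard]; exact Finset.card_image_of_injOn hSinj
  have hTS : ∀ f ∈ T, ∃ Φ, Stacked n f Φ := by
    intro f hf
    obtain ⟨s, hs, rfl⟩ := Finset.mem_image.1 hf
    exact ⟨s.2, hS s hs⟩
  have hTa : ∀ f ∈ T, IsAttachment f n := fun f hf => (hTS f hf).choose_spec.isAttachment
  have hTne : T.Nonempty := by rw [← Finset.card_pos, hTcard]; positivity
  let : Fintype (SimpleLabelledOrderType n) := Fintype.ofFinite _
  -- `A` is realisation with the given labels, used for the first graph only; `R` allows relabelling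
  -- and governs the remaining graphs.
  let A : SimpleLabelledOrderType n → (ℕ → Finset ℕ) → Prop := fun t f =>
    IsStraightLineEmbedding (stackGraph f n) t.rep.point
  let R : SimpleLabelledOrderType n → (ℕ → Finset ℕ) → Prop := fun t f =>
    ∃ π : Equiv.Perm (Fin n), IsStraightLineEmbedding (stackGraph f n) (t.rep.point ∘ π)
  have hA : ∀ t ∈ (Finset.univ : Finset (SimpleLabelledOrderType n)),
      (T.filter (A t)).card ≤ 1 := by
    intro t _
    rw [Finset.card_le_one]
    intro f hf g hg
    obtain ⟨hfT, hfA⟩ := Finset.mem_filter.1 hf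
    obtain ⟨hgT, hgA⟩ := Finset.mem_filter.1 hg
    exact (hTa f hfT).eq_of_isStraightLineEmbedding (hTa g hgT) t.rep.inGeneralPos hfA hgA
  have hR : ∀ t, (T.filter (R t)).card ≤ n.factorial := by
    intro t
    have hex : ∀ f ∈ T.filter (R t), ∃ π : Equiv.Perm (Fin n),
        IsStraightLineEmbedding (stackGraph f n) (t.rep.point ∘ π) :=
      fun f hf => (Finset.mem_filter.1 hf).2
    choose! π hπ using hex
    -- By uniqueness on labelled points, a permutation serves at most one graph.
    have := Finset.card_le_card_of_injOn (s := T.filter (R t))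
      (t := (Finset.univ : Finset (Equiv.Perm (Fin n)))) π (fun _ _ => Finset.mem_univ _)
      (by
        intro f hf g hg hfg
        have hf' := hπ f hf
        rw [hfg] at hf'
        exact (hTa f (Finset.mem_of_mem_filter f hf)).eq_of_isStraightLineEmbedding
          (hTa g (Finset.mem_of_mem_filter g hg)) (t.rep.inGeneralPos.comp (π g).injective)
          hf' (hπ g hg))
    rwa [Finset.card_univ, Fintype.card_perm, Fintype.card_fin] at this
  obtain ⟨f₁, hf₁, hle⟩ := exists_card_filter_mul_le A Finset.univ T hTne 1 hA
  refine ⟨(Finset.univ.filter fun t => A t f₁).card, ?_, ?_, fun k hk => ?_⟩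
  -- The chosen graph has a drawing in general position, so at least one order type realises it.
  · rw [Finset.card_pos]
    obtain ⟨Φ, hΦ⟩ := hTS f₁ hf₁
    obtain ⟨p, hp, hp'⟩ := hΦ.exists_isStraightLineEmbedding
    exact ⟨Quotient.mk _ (hp.toSimple hp'.injective), Finset.mem_filter.2 ⟨Finset.mem_univ _,
      IsStraightLineEmbedding.rep hp hp'.injective Function.injective_id hp'⟩⟩
  · rwa [hTcard, mul_one, Finset.card_univ, ← Nat.card_eq_fintype_card] at hle
  · rw [← hTcard] at hk
    obtain ⟨𝒢, h𝒢, hcard, hun⟩ := exists_small_unrelated R T n.factorial k _ (fun t _ => hR t) hk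
    refine ⟨(insert f₁ 𝒢).image fun f => stackGraph f n, ⟨?_, fun hsim => ?_⟩,
      Finset.card_image_le.trans ((Finset.card_insert_le _ _).trans (by omega))⟩
    · intro G hG
      obtain ⟨f, hf, rfl⟩ := Finset.mem_image.1 hG
      obtain ⟨Φ, hΦ⟩ := hTS f (Finset.insert_subset hf₁ h𝒢 hf)
      obtain ⟨p, -, hp⟩ := hΦ.exists_isStraightLineEmbedding
      exact hp.isPlanar
    · obtain ⟨t, ht, hall⟩ := hsim.exists_rep
        (Finset.mem_image_of_mem _ (Finset.mem_insert_self f₁ 𝒢))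
      obtain ⟨f, hf, hnot⟩ := hun t (Finset.mem_filter.2 ⟨Finset.mem_univ _, ht⟩)
      exact hnot (hall _ (Finset.mem_image_of_mem _ (Finset.mem_insert_of_mem hf)))

/-! ### Numerical estimates and conclusion. -/

theorem sixteen_mul_lt_two_pow (n : ℕ) (hn : 16 ≤ n) :
    16 * (n : ℝ) * ((n : ℝ) - 1) * ((n : ℝ) - 2) < 2 ^ n := by
  induction n, hn using Nat.le_induction with
  -- Here 53760 < 65536; for n = 15 the inequality fails, as 43680 > 32768. This is what makes the
  -- denominator of the bound positive.
  | base => norm_num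
  | succ n hn ih =>
    have h16 : (16 : ℝ) ≤ n := by exact_mod_cast hn
    push_cast
    rw [pow_succ]
    have : (n : ℝ) * ((n : ℝ) - 1) * ((n : ℝ) + 1) ≤ (n : ℝ) * ((n : ℝ) - 1) * (2 * ((n : ℝ) - 2)) :=
      mul_le_mul_of_nonneg_left (by linarith) (mul_nonneg (by linarith) (by linarith))
    nlinarith

theorem sigma_le_card {n : ℕ} {𝒢 : Finset (SimpleGraph (Fin n))} (h : IsConflictCollection 𝒢) :
    sigma n ≤ 𝒢.card := iInf₂_le 𝒢 h

end PlanarConflict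

theorem mainTheorem4 (n : ℕ) (hn : 16 ≤ n) :
    ∃ m : ℕ, PlanarConflict.sigma n = (m : ℕ∞) ∧
      (m : ℤ) ≤ ⌊(Real.logb 2 (PlanarConflict.numSimpleOrderTypes n : ℝ) - ((n : ℝ) - 4)
            - Real.logb 2 ((n - 3).factorial : ℝ)) /
          ((n : ℝ) - Real.logb 2 (16 * (n : ℝ) * ((n : ℝ) - 1) * ((n : ℝ) - 2)))⌋ + 2 := by
  obtain ⟨M, hM, hMle, hconf⟩ := PlanarConflict.exists_conflictCollection n (by omega)
  set Q : ℝ := Real.logb 2 (PlanarConflict.numSimpleOrderTypes n : ℝ) - ((n : ℝ) - 4)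
            - Real.logb 2 ((n - 3).factorial : ℝ) with hQ
  set L : ℝ := (n : ℝ) - Real.logb 2 (16 * (n : ℝ) * ((n : ℝ) - 1) * ((n : ℝ) - 2)) with hL
  have h16 : (16 : ℝ) ≤ n := by exact_mod_cast hn
  have hprod : 0 < 16 * (n : ℝ) * ((n : ℝ) - 1) * ((n : ℝ) - 2) :=
    mul_pos (mul_pos (by linarith) (by linarith)) (by linarith)
  have hfac : 0 < ((n - 3).factorial : ℝ) := by exact_mod_cast Nat.factorial_pos _
  have hnfac : 0 < (n.factorial : ℝ) := by exact_mod_cast Nat.factorial_pos _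
  have hMpos : 0 < (M : ℝ) := by exact_mod_cast hM
  set T : ℕ := 2 ^ (n - 4) * (n - 3).factorial with hT
  have hTpos : 0 < (T : ℝ) := by
    have : 0 < T := by positivity
    exact_mod_cast this
  have hlogT : Real.logb 2 (T : ℝ) = ((n : ℝ) - 4) + Real.logb 2 ((n - 3).factorial : ℝ) := by
    rw [hT, Nat.cast_mul, Real.logb_mul (by positivity) hfac.ne']
    push_cast
    rw [Real.logb_pow, Real.logb_self_eq_one (by norm_num), mul_one, Nat.cast_sub (by omega)]
    norm_num
  have hLpos : 0 < L := by
    have h1 := Real.logb_lt_logb (b := 2) (by norm_num) hprod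
      (PlanarConflict.sixteen_mul_lt_two_pow n hn)
    rw [Real.logb_pow, Real.logb_self_eq_one (by norm_num), mul_one] at h1
    linarith
  -- The denominator is the number of bits by which each further graph reduces the surviving order
  -- types.
  have hL' : L = Real.logb 2 (T : ℝ) - Real.logb 2 (n.factorial : ℝ) := by
    have h1 : (n.factorial : ℝ) * 16 =
        (16 * (n : ℝ) * ((n : ℝ) - 1) * ((n : ℝ) - 2)) * ((n - 3).factorial : ℝ) := by
      obtain ⟨k, rfl⟩ : ∃ k, n = k + 3 := ⟨n - 3, by omega⟩
      simp only [Nat.add_sub_cancel, Nat.factorial_succ]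
      push_cast
      ring
    have h2 := congrArg (Real.logb 2) h1
    rw [Real.logb_mul hnfac.ne' (by norm_num), Real.logb_mul hprod.ne' hfac.ne',
      show (16 : ℝ) = 2 ^ 4 by norm_num, Real.logb_pow, Real.logb_self_eq_one (by norm_num),
      show ((2 : ℝ) ^ 4) = 16 by norm_num] at h2
    rw [hlogT, hL]
    push_cast at h2
    linarith
  have hMQ : Real.logb 2 (M : ℝ) ≤ Q := by
    have h1 : (M : ℝ) * T ≤ PlanarConflict.numSimpleOrderTypes n := by exact_mod_cast hMle
    have h2 := Real.logb_le_logb_of_le (b := 2) (by norm_num) (mul_pos hMpos hTpos) h1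
    rw [Real.logb_mul hMpos.ne' hTpos.ne'] at h2
    linarith
  have hQ0 : 0 ≤ Q := by
    refine le_trans ?_ hMQ
    exact Real.logb_nonneg (by norm_num) (by exact_mod_cast hM)
  have hfloor : 0 ≤ ⌊Q / L⌋ := Int.floor_nonneg.2 (div_nonneg hQ0 hLpos.le)
  -- The least integer exceeding Q / L: the number of rounds. The first graph accounts for the
  -- remaining 1 in the bound.
  obtain ⟨k, hk⟩ := Int.eq_ofNat_of_zero_le (by omega : 0 ≤ ⌊Q / L⌋ + 1)
  have hkQ : Q < k * L := by
    rw [← div_lt_iff₀ hLpos]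
    have h1 := Int.lt_floor_add_one (Q / L)
    have h2 : ((⌊Q / L⌋ : ℝ) + 1) = k := by exact_mod_cast hk
    linarith
  obtain ⟨𝒢, h𝒢, hcard⟩ := hconf k (by
    have : (M : ℝ) * (n.factorial : ℝ) ^ k < (T : ℝ) ^ k := by
      rw [← Real.logb_lt_logb_iff (b := 2) (by norm_num) (by positivity) (by positivity),
        Real.logb_mul hMpos.ne' (by positivity), Real.logb_pow, Real.logb_pow]
      rw [hL', mul_sub] at hkQ
      linarith
    exact_mod_cast this)
  have hsig : PlanarConflict.sigma n ≤ ((k + 1 : ℕ) : ℕ∞) :=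
    (PlanarConflict.sigma_le_card h𝒢).trans (by exact_mod_cast hcard)
  obtain ⟨m, hm⟩ := ENat.ne_top_iff_exists.1 (ne_top_of_le_ne_top (ENat.natCast_ne_top _) hsig)
  refine ⟨m, hm.symm, ?_⟩
  rw [← hm] at hsig
  have : m ≤ k + 1 := by exact_mod_cast hsig
  omega
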